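/- Let $\mathbb K$ be an algebraically closed field of characteristic zero and let $f(Y)=Y^n+a_1Y^{n-1}+\cdots+a_n\in\mathbb K[[X_1,\dots,X_d]][Y]$ be a quasi-ordinary Weierstrass polynomial, i.e. $a_i(0)=0$ for all $i$ and the $Y$-discriminant of $f$ equals $X_1^{\alpha_1}\cdots X_d^{\alpha_d}u$ with $\alpha_i\in\mathbb N$, $u\in\mathbb K[[X_1,\dots,X_d]]$, $u(0)\neq 0$. Let $\mathrm{Zer}\, f$ be the set of the roots of $f$ in the rings $\mathbb K[[X_1^{1/k},\dots,X_d^{1/k}]]$, $k\ge 1$. For different roots $y,z$ the contact $O(y,z)\in\mathbb Q_{\ge0}^d$ is the exponent $\lambda$ with $y-z=\underline X^{\lambda}u$, where $u$ is a power series in $X_1^{1/k},\dots,X_d^{1/k}$ for some $k\ge 1$ and $u(0)\ne0$; put $O(y,y)=+\infty$. Order $\mathbb Q^d$ componentwise, with $\alpha<+\infty$ for every $\alpha\in\mathbb Q^d$. The tree model $T(f)$ is the following collection of sets of roots, called bars. The height $h(B)$ of a bar $B$ is the smallest contact between elements of $B$ (including $O(y,y)$). The set $\mathrm{Zer}\,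 f$ is a bar; and if $B$ is a bar of finite height, then the equivalence classes of the relation $O(y,z)>h(B)$ on $B$, called the postbars of $B$, are bars. Let $h_1,\dots,h_g\in\mathbb Q_{\ge 0}^d$ ($g\ge 0$), let $h_{g+1}=\infty$, and let $N_i=\mathbb Z^d+\mathbb Zh_1+\cdots+\mathbb Zh_i$ for $0\le i\le g$. The tree model $T(f)$ is said to be of type $(h_1,\dots,h_g)$ if (i) the set of the heights of the bars of $T(f)$ is $\{h_1,\dots,h_g,h_{g+1}\}$, and (ii) for $i=1,\dots,g$, every bar of height $h_i$ has exactly $[N_i:N_{i-1}]$ postbars and all of them have the height $h_{i+1}$. **Theorem.** If the tree model $T(f)$ is of type $(h_1,\dots,h_g)$, then $f$ is irreducible in $\mathbb K[[X_1,\dots,X_d]][Y]$, and $h_1,\dots,h_g$ is its sequence of characteristic exponents, i.e. $h_1<h_2<\cdots<h_g$ and, for every root $y\in\mathrm{Zer}\, f$ (there is at least one), $\{O(z,y): z\in\mathrm{Zer}\, f,\ z\neq y\}=\{h_1,\dots,h_g\}$. -/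

import Mathlib

open Polynomial

noncomputable section

namespace QuasiOrdinary

/-- A polynomial `f(Y) = Yⁿ + a₁Yⁿ⁻¹ + ⋯ + aₙ` over `K[[X₁,…,X_d]]` is a Weierstrass polynomial if
it is monic and `aᵢ(0) = 0` for all `i = 1,…,n`. -/
def IsWeierstrass {K : Type*} [Field K] {d : ℕ} (f : (MvPowerSeries (Fin d) K)[X]) : Prop :=
  f.Monic ∧ ∀ i < f.natDegree, MvPowerSeries.constantCoeff (f.coeff i) = 0

/-- A monic polynomial `f(Y)` over `K[[X₁,…,X_d]]` is quasi-ordinary if its `Y`-discriminant is a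
monomial `X₁^α₁⋯X_d^α_d` times a power series `u` with `u(0) ≠ 0`. -/
def IsQuasiOrdinary {K : Type*} [Field K] {d : ℕ} (f : (MvPowerSeries (Fin d) K)[X]) : Prop :=
  f.Monic ∧ ∃ (α : Fin d →₀ ℕ) (u : MvPowerSeries (Fin d) K),
    MvPowerSeries.constantCoeff u ≠ 0 ∧ f.discr = MvPowerSeries.monomial α 1 * u

/-- The ambient ring in which power series with rational exponents live: the generalized (Hahn)
series in `X₁,…,X_d` with exponents in `ℚ^d`, ordered componentwise, and coefficients in `K`. -/
abbrev Ambient (K : Type*) [Field K] (d : ℕ) : Type _ := HahnSeries (Fin d → ℚ) K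

/-- The inclusion `ℕ^d → ℚ^d` of exponents. -/
def expHom (d : ℕ) : (Fin d →₀ ℕ) →+ (Fin d → ℚ) where
  toFun m := fun i => (m i : ℚ)
  map_zero' := by ext i; simp
  map_add' a b := by ext i; simp

theorem expHom_injective (d : ℕ) : Function.Injective (expHom d) := by
  intro a b hab
  ext i
  have := congrFun hab i
  simpa [expHom] using this

theorem expHom_le_iff (d : ℕ) (a b : Fin d →₀ ℕ) : expHom d a ≤ expHom d b ↔ a ≤ b := by
  simp [expHom, Pi.le_def, Finsupp.le_def]

/-- The inclusion of `K[[X₁,…,X_d]]` into the ambient ring. -/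
def incl (K : Type*) [Field K] (d : ℕ) : MvPowerSeries (Fin d) K →+* Ambient K d :=
  (HahnSeries.embDomainRingHom (expHom d) (expHom_injective d) (expHom_le_iff d)).comp
    (HahnSeries.toMvPowerSeries (σ := Fin d) (R := K)).symm.toRingHom

/-- The ring `K[[X₁^{1/k},…,X_d^{1/k}]]` of power series with exponents in `(1/k)ℕ^d`. -/
def FracPowerSeries (K : Type*) [Field K] (d k : ℕ) : Set (Ambient K d) :=
  {s | ∀ a ∈ s.support, ∀ i, ∃ m : ℕ, a i = (m : ℚ) / (k : ℚ)}

/-- `Zer f`: the set of the roots of `f(Y)` lying in `K[[X₁^{1/k},…,X_d^{1/k}]]` for some positive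
integer `k`. -/
def Zer {K : Type*} [Field K] {d : ℕ} (f : (MvPowerSeries (Fin d) K)[X]) : Set (Ambient K d) :=
  {y | (∃ k : ℕ, 0 < k ∧ y ∈ FracPowerSeries K d k) ∧ f.eval₂ (incl K d) y = 0}

/-- `y - z = X^l u` where, for some positive integer `k`, `u ∈ K[[X₁^{1/k},…,X_d^{1/k}]]` has
`u(0) ≠ 0`. There is at most one such `l`, and none if `y = z`. -/
def HasContact {K : Type*} [Field K] {d : ℕ} (y z : Ambient K d) (l : Fin d → ℚ) : Prop :=
  ∃ k : ℕ, 0 < k ∧ ∃ u ∈ FracPowerSeries K d k, u.coeff 0 ≠ 0 ∧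
    y - z = HahnSeries.single l (1 : K) * u

open Classical in
/-- The contact `O(y, z)`: the exponent `l` with `y - z = X^l u`, `u(0) ≠ 0`, and `+∞` if `y = z`.
(Any two different roots of a quasi-ordinary polynomial have such an `l`; the value `⊤` at other
pairs of different series is never used.) The order of `WithTop (Fin d → ℚ)` is the componentwise
partial order of `ℚ^d` with a largest element `⊤` added. -/
def contact {K : Type*} [Field K] {d : ℕ} (y z : Ambient K d) : WithTop (Fin d → ℚ) :=
  if h : ∃ l, HasContact y z l then ((h.choose : Fin d → ℚ) : WithTop (Fin d → ℚ)) else ⊤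

/-- `c` is the height `h(B)` of `B`: the minimal contact between the elements of `B`. -/
def IsHeight {K : Type*} [Field K] {d : ℕ} (B : Set (Ambient K d)) (c : WithTop (Fin d → ℚ)) :
    Prop :=
  IsLeast {l | ∃ y ∈ B, ∃ z ∈ B, contact y z = l} c

/-- `B ⊥ B'`: the bar `B` has finite height `h` and `B'` is an equivalence class of the relation
`z ≡ y mod h⁺`, that is `O(z, y) > h`, on `B`. -/
def IsPostbar {K : Type*} [Field K] {d : ℕ} (B B' : Set (Ambient K d)) : Prop :=
  ∃ h : Fin d → ℚ, IsHeight B (h : WithTop (Fin d → ℚ)) ∧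
    ∃ y ∈ B, B' = {z | z ∈ B ∧ (h : WithTop (Fin d → ℚ)) < contact z y}

/-- The bars of the tree built on a set `Z` of series: the lowest bar is `Z`, and with every bar
its postbars are bars. Bars of infinite height are included. -/
inductive IsBar {K : Type*} [Field K] {d : ℕ} (Z : Set (Ambient K d)) : Set (Ambient K d) → Prop
  | root : IsBar Z Z
  | postbar (B B' : Set (Ambient K d)) : IsBar Z B → IsPostbar B B' → IsBar Z B'

/-- The tree model `T(f)`, as the set of its bars. -/
def treeModel {K : Type*} [Field K] {d : ℕ} (f : (MvPowerSeries (Fin d) K)[X]) :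
    Set (Set (Ambient K d)) :=
  {B | IsBar (Zer f) B}

/-- The lattice `Nᵢ = ℤ^d + ℤh₁ + ⋯ + ℤhᵢ`. The sequence `h₁,…,h_g` is indexed by `Fin g`, so that
`hᵢ` is the value of `h` at `i - 1`. -/
def lattice {d g : ℕ} (h : Fin g → Fin d → ℚ) (i : ℕ) : AddSubgroup (Fin d → ℚ) :=
  AddSubgroup.closure
    (Set.range (fun (m : Fin d → ℤ) (j : Fin d) => (m j : ℚ)) ∪ h '' {j | (j : ℕ) < i})

/-- The sequence `h₁,…,h_g` (indexed from `0`) continued by `h_{g+1} = ∞`. -/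
def heightSeq {d g : ℕ} (h : Fin g → Fin d → ℚ) (i : ℕ) : WithTop (Fin d → ℚ) :=
  if hi : i < g then ((h ⟨i, hi⟩ : Fin d → ℚ) : WithTop (Fin d → ℚ)) else ⊤

/-- A tree model `T` is a tree of type `(h₁,…,h_g)`. -/
structure IsTreeOfType {K : Type*} [Field K] {d g : ℕ} (T : Set (Set (Ambient K d)))
    (h : Fin g → Fin d → ℚ) : Prop where
  /-- The set of the heights of the bars of `T` is `{h₁,…,h_g,∞}`. -/
  heights : {c | ∃ B ∈ T, IsHeight B c} =
    insert ⊤ (Set.range fun i : Fin g => ((h i : Fin d → ℚ) : WithTop (Fin d → ℚ)))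
  /-- Every bar of height `hᵢ` has `[Nᵢ : Nᵢ₋₁]` postbars. -/
  card_postbars : ∀ i : Fin g, ∀ B ∈ T, IsHeight B (h i : WithTop (Fin d → ℚ)) →
    {B' | IsPostbar B B'}.ncard = (lattice h i).relIndex (lattice h (i + 1))
  /-- All the postbars of a bar of height `hᵢ` have the height `hᵢ₊₁`. -/
  height_postbars : ∀ i : Fin g, ∀ B ∈ T, IsHeight B (h i : WithTop (Fin d → ℚ)) →
    ∀ B', IsPostbar B B' → IsHeight B' (heightSeq h (i + 1))

/-- `h₁ < ⋯ < h_g` is the sequence of characteristic exponents of (the irreducible polynomial) `f`: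
`f` has a root, and for every root `y` of `f` the set of the contacts of `y` with the other roots
is `{h₁,…,h_g}`. -/
def IsCharacteristicSequence {K : Type*} [Field K] {d g : ℕ} (f : (MvPowerSeries (Fin d) K)[X])
    (h : Fin g → Fin d → ℚ) : Prop :=
  StrictMono h ∧ (Zer f).Nonempty ∧ ∀ y ∈ Zer f,
    {c | ∃ z ∈ Zer f, z ≠ y ∧ contact z y = c} =
      Set.range fun i : Fin g => ((h i : Fin d → ℚ) : WithTop (Fin d → ℚ))

end QuasiOrdinary

end

/-! The argument compares two counts of roots. Let `n = deg f`. By the Abhyankar–Jung theorem `Zer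
f` has exactly `n` elements. Multiplying the numbers of postbars along the tree gives `n ≤ [N_g :
N_0]` (`ncard_le_relIndex`). Conversely, two roots with contact `hᵢ` have different coefficients at
`hᵢ`, so one of them has `hᵢ` in its support. Descending into the class of such a root at every
level produces a root `y` whose support contains all the `hᵢ`. The characters of `N_g / N_0` act on
series by multiplying monomials, fix the power series with integer exponents, and move `y` to `[N_g
: N_0]` distinct conjugates. A monic factor of `f` vanishing at `y` therefore has degree at least
`n`, which is irreducibility. The statement on contacts comes from following one root up through its
bars.

Most of the work is Abhyankar–Jung. Each weight `w` on `ℚ^d` refines the componentwise order to a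
linear one, whose Hahn series form an algebraically closed field; there `f` has `n` roots. Twisting
by characters of one coordinate shows that the denominators of their exponents are at most `n`, and
for the weight given by the `j`-th coordinate the `j`-th exponents are nonnegative.

The remaining point is to pass from these coordinate weights to all coordinates for an arbitrary
weight. A polynomial identity with power series coefficients makes sense in all these fields
simultaneously, and `IsRationalFamily` records quantities given by such identities. As the
discriminant is a monomial times a unit, these families are stable under the logarithmic derivations
`θ_j`. For `e = n!` the operator `∏_{i < eM} (θ_j - i/e)` kills the exponents `0, 1/e, …, M - 1/e`
in the `j`-th coordinate, so it makes a root divisible by `X_j^M`. Lagrange interpolation turns this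
into an identity valid for every weight. An exponent outside `(1/e)ℕ` would survive all these
operators, for every `M`, and this contradicts well-ordering. -/

/-! ### Newton's method: algebraically closed fields of Hahn series. -/

namespace HahnSeries

/-- Spherical completeness: compatible approximations `y` up to the precision `ρ y` have a common
limit. -/
theorem exists_limit {Γ K : Type*} [LinearOrder Γ] [AddGroup K] (c : Set (HahnSeries Γ K))
    (ρ : HahnSeries Γ K → Γ)
    (hc : ∀ y ∈ c, ∀ z ∈ c, ∀ γ, γ < ρ y → γ < ρ z → y.coeff γ = z.coeff γ) :
    ∃ x : HahnSeries Γ K, ∀ y ∈ c, (ρ y : WithTop Γ) ≤ (x - y).orderTop := by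
  classical
  let φ : Γ → K := fun γ => if h : ∃ y ∈ c, γ < ρ y then h.choose.coeff γ else 0
  have hφ : ∀ y ∈ c, ∀ γ, γ < ρ y → φ γ = y.coeff γ := fun y hy γ hγ => by
    have h : ∃ y ∈ c, γ < ρ y := ⟨y, hy, hγ⟩
    simp only [φ, dif_pos h]
    exact hc _ h.choose_spec.1 y hy γ h.choose_spec.2 hγ
  have hpwo : (Function.support φ).IsPWO := by
    rw [Set.IsPWO, Set.partiallyWellOrderedOn_iff_exists_lt]
    intro s hs
    -- If no later term is at least `s 0`, the whole sequence lies below the precision of a single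
    -- `y`, where `φ` agrees with `y`.
    by_cases hex : ∃ n, 0 < n ∧ s 0 ≤ s n
    · obtain ⟨n, hn, hle⟩ := hex
      exact ⟨0, n, hn, hle⟩
    push Not at hex
    have h0 : ∃ y ∈ c, s 0 < ρ y := by
      by_contra hno
      have := hs 0
      simp only [φ, Function.mem_support, dif_neg hno, ne_eq, not_true_eq_false] at this
    obtain ⟨y, hy, hlt⟩ := h0
    refine Set.partiallyWellOrderedOn_iff_exists_lt.1 y.isPWO_support s fun n => ?_
    have hsn : s n < ρ y := by
      rcases Nat.eq_zero_or_pos n with rfl | hn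
      · exact hlt
      · exact (hex n hn).trans hlt
    rw [mem_support, ← hφ y hy _ hsn]
    exact hs n
  refine ⟨⟨φ, hpwo⟩, fun y hy => ?_⟩
  rw [le_orderTop_iff_forall]
  intro γ hγ
  rw [coeff_sub, sub_eq_zero]
  exact hφ y hy γ (WithTop.coe_lt_coe.1 hγ)

variable {Γ K : Type*} [AddCommGroup Γ] [LinearOrder Γ] [IsOrderedAddMonoid Γ] [Field K]

/-- `ρ` is a slope of the Newton polygon of `f(y + Z)` meeting its constant term: the line of slope
`ρ` through the constant term supports the polygon and contains another vertex. -/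
structure IsNewtonSlope (f : (HahnSeries Γ K)[X]) (y : HahnSeries Γ K) (ρ : Γ) : Prop where
  le : ∀ k, (f.eval y).orderTop ≤ ((taylor y f).coeff k).orderTop + ((k • ρ : Γ) : WithTop Γ)
  exists_eq : ∃ k, 0 < k ∧
    (f.eval y).orderTop = ((taylor y f).coeff k).orderTop + ((k • ρ : Γ) : WithTop Γ)

/-- The slope joining the constant term to the `k`-th Taylor coefficient is a quotient by `k`, which
divisibility provides. The largest of these finitely many slopes is a supporting one. -/
theorem exists_isNewtonSlope (hdiv : ∀ n : ℕ, n ≠ 0 → ∀ γ : Γ, ∃ δ, n • δ = γ)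
    {f : (HahnSeries Γ K)[X]} (hf : f.Monic) (hdeg : 0 < f.natDegree) {y : HahnSeries Γ K}
    (hy : f.eval y ≠ 0) : ∃ ρ, IsNewtonSlope f y ρ := by
  classical
  set b := (taylor y f).coeff with hb
  have hb0 : b 0 = f.eval y := taylor_coeff_zero y f
  have hex : ∀ k, ∃ δ : Γ, k ≠ 0 → k • δ = (b 0).order - (b k).order := fun k => by
    by_cases hk : k = 0
    · exact ⟨0, fun h => absurd hk h⟩
    · obtain ⟨δ, hδ⟩ := hdiv k hk ((b 0).order - (b k).order)
      exact ⟨δ, fun _ => hδ⟩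
  choose δ hδ using hex
  let s := (Finset.Icc 1 f.natDegree).filter fun k => b k ≠ 0
  have hbn : b f.natDegree = 1 := by
    have h1 : (taylor y f).Monic := by
      simpa [taylor_apply] using hf.comp (monic_X_add_C y) (by simp)
    have h2 : (taylor y f).natDegree = f.natDegree := natDegree_taylor f y
    rw [hb, ← h2]; exact h1
  have hs : s.Nonempty := ⟨f.natDegree, by
    simp only [s, Finset.mem_filter, Finset.mem_Icc, hbn]
    exact ⟨⟨hdeg, le_rfl⟩, one_ne_zero⟩⟩
  obtain ⟨m, hms, hmax⟩ := s.exists_max_image δ hs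
  have horder : ∀ k, k ≠ 0 → b k ≠ 0 →
      (b 0).orderTop = (b k).orderTop + ((k • δ k : Γ) : WithTop Γ) := fun k hk hbk => by
    rw [← order_eq_orderTop_of_ne_zero hbk, ← order_eq_orderTop_of_ne_zero (hb0 ▸ hy),
      hδ k hk, ← WithTop.coe_add]
    congr 1; abel
  refine ⟨δ m, ⟨fun k => ?_, m, ?_, ?_⟩⟩
  · rw [← hb0]
    rcases eq_or_ne k 0 with rfl | hk
    · simp [hb0]
    by_cases hbk : b k = 0
    · rw [← hb, hbk]; simp
    · have hkn : k ≤ f.natDegree := by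
        by_contra hlt
        exact hbk (coeff_eq_zero_of_natDegree_lt (by rw [natDegree_taylor]; omega))
      have := hmax k (by simp [s, hbk]; omega)
      rw [horder k hk hbk]
      gcongr
      exact WithTop.coe_le_coe.2 (nsmul_le_nsmul_right this k)
  · simp only [s, Finset.mem_filter, Finset.mem_Icc] at hms; omega
  · simp only [s, Finset.mem_filter, Finset.mem_Icc] at hms
    rw [← hb0]; exact horder m (by omega) hms.2

theorem le_orderTop_eval_of_taylor {f : (HahnSeries Γ K)[X]} {y z : HahnSeries Γ K} {ρ : Γ}
    {g : WithTop Γ}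
    (hg : ∀ k, g ≤ ((taylor y f).coeff k).orderTop + ((k • ρ : Γ) : WithTop Γ))
    (hz : (ρ : WithTop Γ) ≤ (z - y).orderTop) : g ≤ (f.eval z).orderTop := by
  have h1 : f.eval z = (taylor y f).eval (z - y) := by rw [taylor_eval]; simp
  rw [h1, eval_eq_sum_range, ← addVal_apply]
  refine AddValuation.map_le_sum _ fun k _ => ?_
  rw [AddValuation.map_mul, AddValuation.map_pow, addVal_apply, addVal_apply]
  refine (hg k).trans ?_
  gcongr
  rw [WithTop.coe_nsmul]
  exact nsmul_le_nsmul_right hz k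

theorem IsNewtonSlope.le_orderTop_eval {f : (HahnSeries Γ K)[X]} {y z : HahnSeries Γ K} {ρ : Γ}
    (h : IsNewtonSlope f y ρ) (hz : (ρ : WithTop Γ) ≤ (z - y).orderTop) :
    (f.eval y).orderTop ≤ (f.eval z).orderTop :=
  le_orderTop_eval_of_taylor h.le hz

/-- One Newton step: the initial coefficients along the edge of slope `ρ` form a nonconstant
polynomial over `K`. Adding `c t^ρ` to `y`, with `c` a root of it, cancels the leading term of
`f(y)`. -/
theorem IsNewtonSlope.exists_lt_orderTop_eval [IsAlgClosed K] {f : (HahnSeries Γ K)[X]}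
    {y : HahnSeries Γ K} {ρ : Γ} (h : IsNewtonSlope f y ρ) (hy : f.eval y ≠ 0) :
    ∃ z : HahnSeries Γ K, (ρ : WithTop Γ) ≤ (z - y).orderTop ∧
      (f.eval y).orderTop < (f.eval z).orderTop := by
  set g := (f.eval y).order with hgdef
  have hg : (g : WithTop Γ) = (f.eval y).orderTop := order_eq_orderTop_of_ne_zero hy
  set n := (taylor y f).natDegree
  let P : K[X] := ∑ k ∈ Finset.range (n + 1), monomial k (((taylor y f).coeff k).coeff (g - k • ρ))
  have hPc : ∀ k ≤ n, P.coeff k = ((taylor y f).coeff k).coeff (g - k • ρ) := fun k hk => by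
    simp only [P, finsetSum_coeff, coeff_monomial]
    rw [Finset.sum_eq_single k] <;> simp +contextual; omega
  obtain ⟨k, hk0, hk⟩ := h.exists_eq
  have hbk : (taylor y f).coeff k ≠ 0 := fun h0 => by
    rw [h0, orderTop_zero, WithTop.top_add] at hk
    exact hy (orderTop_eq_top.1 hk)
  have hkn : k ≤ n := le_natDegree_of_ne_zero hbk
  have hPk : P.coeff k ≠ 0 := by
    rw [hPc k hkn]
    have h2 : g - k • ρ = ((taylor y f).coeff k).order := by
      rw [← hg, ← order_eq_orderTop_of_ne_zero hbk, ← WithTop.coe_add, WithTop.coe_eq_coe] at hk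
      rw [hk]; abel
    rw [h2]; exact coeff_order_eq_zero.not.2 hbk
  obtain ⟨c, hc⟩ := IsAlgClosed.exists_root P (by
    intro h0
    have : P.natDegree = 0 := natDegree_eq_of_degree_eq_some h0
    exact absurd (le_natDegree_of_ne_zero hPk) (by omega))
  refine ⟨y + single ρ c, ?_, ?_⟩
  · rw [add_sub_cancel_left]; exact orderTop_single_le
  have hle : (f.eval y).orderTop ≤ (f.eval (y + single ρ c)).orderTop :=
    h.le_orderTop_eval (by rw [add_sub_cancel_left]; exact orderTop_single_le)
  refine lt_of_le_of_ne hle fun heq => ?_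
  rw [← hg] at heq
  refine coeff_orderTop_ne heq.symm ?_
  have h1 : f.eval (y + single ρ c) = (taylor y f).eval (single ρ c) := by
    rw [taylor_eval, add_comm]
  rw [h1, eval_eq_sum_range, coeff_sum]
  rw [IsRoot.def, eval_eq_sum_range' (n := n + 1)] at hc
  · rw [← hc]
    refine Finset.sum_congr rfl fun k hk => ?_
    rw [hPc k (by simpa [Nat.lt_succ_iff] using hk), single_pow, coeff_mul_single]
  · refine Nat.lt_succ_of_le (natDegree_sum_le_of_forall_le _ _ fun k hk => ?_)
    exact (natDegree_monomial_le _).trans (by simpa [Nat.lt_succ_iff] using hk)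

/-- Zorn's lemma for the relation "`z` improves `y`": limits of chains exist by spherical
completeness, and a maximal element that is not a root could be improved by a Newton step. -/
theorem exists_root_of_divisible [IsAlgClosed K]
    (hdiv : ∀ n : ℕ, n ≠ 0 → ∀ γ : Γ, ∃ δ, n • δ = γ) {f : (HahnSeries Γ K)[X]} (hf : f.Monic)
    (hdeg : 0 < f.natDegree) : ∃ y, f.eval y = 0 := by
  by_contra! hne
  choose ρ hρ using fun y => exists_isNewtonSlope hdiv hf hdeg (hne y)
  -- Slopes do not decrease under improvement: with a smaller slope at `z`, the point `y` would lie
  -- in the ball around `z` on which `f` has order at least that of `f(z)`.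
  have hmono : ∀ y z, (f.eval y).orderTop < (f.eval z).orderTop →
      (ρ y : WithTop Γ) ≤ (z - y).orderTop → ρ y ≤ ρ z := fun y z hlt hle => by
    by_contra! hcon
    refine absurd ((hρ z).le_orderTop_eval (z := y) ?_) (not_le.2 hlt)
    rw [← neg_sub, orderTop_neg]
    exact (WithTop.coe_le_coe.2 hcon.le).trans hle
  let r : HahnSeries Γ K → HahnSeries Γ K → Prop := fun y z =>
    y = z ∨ ((f.eval y).orderTop < (f.eval z).orderTop ∧ (ρ y : WithTop Γ) ≤ (z - y).orderTop)
  have hchain : ∀ c, IsChain r c → ∃ ub, ∀ a ∈ c, r a ub := by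
    intro c hc
    by_cases hmax : ∃ m ∈ c, ∀ a ∈ c, r a m
    · obtain ⟨m, _, h⟩ := hmax
      exact ⟨m, h⟩
    push Not at hmax
    have hcoh : ∀ y z, r y z → ∀ γ, γ < ρ y → y.coeff γ = z.coeff γ := by
      rintro y z (rfl | ⟨_, h⟩) γ hγ
      · rfl
      have := coeff_eq_zero_of_lt_orderTop ((WithTop.coe_lt_coe.2 hγ).trans_le h)
      rw [coeff_sub, sub_eq_zero] at this
      exact this.symm
    obtain ⟨x, hx⟩ := exists_limit c ρ fun y hy z hz γ h1 h2 => by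
      rcases eq_or_ne y z with rfl | hyz
      · rfl
      rcases hc hy hz hyz with h | h
      · exact hcoh y z h γ h1
      · exact (hcoh z y h γ h2).symm
    -- The chain has no greatest element, so some `z` in it strictly improves `y`; then `f(x)` has
    -- order at least that of `f(z)`.
    refine ⟨x, fun y hy => Or.inr ⟨?_, hx y hy⟩⟩
    obtain ⟨z, hz, hzy⟩ := hmax y hy
    have hne' : z ≠ y := fun h => hzy (Or.inl h)
    rcases (hc hz hy hne').resolve_left hzy with h | h
    · exact absurd h.symm hne'
    · exact h.1.trans_le ((hρ z).le_orderTop_eval (hx z hz))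
  have htrans : ∀ {a b c}, r a b → r b c → r a c := by
    rintro a b c (rfl | ⟨h1, h2⟩) (rfl | ⟨h3, h4⟩)
    · exact Or.inl rfl
    · exact Or.inr ⟨h3, h4⟩
    · exact Or.inr ⟨h1, h2⟩
    · refine Or.inr ⟨h1.trans h3, ?_⟩
      have h5 : c - a = (c - b) + (b - a) := by abel
      rw [h5]
      refine le_trans (le_min ?_ h2) min_orderTop_le_orderTop_add
      exact (WithTop.coe_le_coe.2 (hmono a b h1 h2)).trans h4
  obtain ⟨m, hm⟩ := exists_maximal_of_chains_bounded hchain htrans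
  obtain ⟨z, hz, hlt⟩ := (hρ m).exists_lt_orderTop_eval (hne m)
  rcases hm z (Or.inr ⟨hlt, hz⟩) with h | h
  · exact absurd hlt (by rw [h]; exact lt_irrefl _)
  · exact lt_asymm hlt h.1

/-- Hahn series with exponents in a divisible linearly ordered group and coefficients in an
algebraically closed field form an algebraically closed field. -/
theorem isAlgClosed_of_divisible [IsAlgClosed K]
    (hdiv : ∀ n : ℕ, n ≠ 0 → ∀ γ : Γ, ∃ δ, n • δ = γ) : IsAlgClosed (HahnSeries Γ K) :=
  IsAlgClosed.of_exists_root _ fun _ hp hirr =>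
    exists_root_of_divisible hdiv hp hirr.natDegree_pos

end HahnSeries

/-! ### Change of order, logarithmic derivations, character twists, and supports. -/

namespace HahnSeries

section Reorder

variable {Γ Γ' R : Type*} [AddCommMonoid Γ] [PartialOrder Γ] [IsOrderedCancelAddMonoid Γ]
  [AddCommMonoid Γ'] [PartialOrder Γ'] [IsOrderedCancelAddMonoid Γ'] [CommRing R]

/-- A monotone additive bijection `φ` of the exponents (whose inverse need not be monotone) induces
a ring homomorphism of Hahn series. -/
noncomputable def reorder (φ : Γ ≃+ Γ') (hφ : Monotone φ) :
    HahnSeries Γ R →+* HahnSeries Γ' R where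
  toFun x := ⟨fun b => x.coeff (φ.symm b), by
    refine (x.isPWO_support.image_of_monotone hφ).mono fun b hb => ?_
    exact ⟨φ.symm b, hb, by simp⟩⟩
  map_zero' := by ext; simp
  map_one' := by
    ext b
    by_cases h : b = 0
    · simp [h, coeff_one]
    · have h' : φ.symm b ≠ 0 := by simpa using h
      simp [h, h', coeff_one]
  map_add' x y := by ext; simp
  map_mul' x y := by
    ext b
    simp only [coeff_mul]
    refine Finset.sum_nbij' (fun p => (φ p.1, φ p.2)) (fun p => (φ.symm p.1, φ.symm p.2))
      ?_ ?_ ?_ ?_ ?_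
    · rintro ⟨p, q⟩ h
      simp only [Finset.mem_antidiagonal, mem_support] at h ⊢
      simp only [AddEquiv.symm_apply_apply]
      exact ⟨h.1, h.2.1, by rw [← map_add, h.2.2]; simp⟩
    · rintro ⟨p, q⟩ h
      simp only [Finset.mem_antidiagonal, mem_support] at h ⊢
      exact ⟨h.1, h.2.1, by rw [← map_add, h.2.2]⟩
    · simp
    · simp
    · simp

@[simp]
theorem coeff_reorder (φ : Γ ≃+ Γ') (hφ : Monotone φ) (x : HahnSeries Γ R) (b : Γ') :
    (reorder φ hφ x).coeff b = x.coeff (φ.symm b) := rfl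

theorem reorder_injective (φ : Γ ≃+ Γ') (hφ : Monotone φ) :
    Function.Injective (reorder (R := R) φ hφ) := fun x y h => by
  ext a
  simpa using congrArg (fun s : HahnSeries Γ' R => s.coeff (φ a)) h

end Reorder

variable {Γ K : Type*} [AddCommGroup Γ] [PartialOrder Γ] [IsOrderedAddMonoid Γ] [Field K]

/-- The derivation multiplying the monomial of exponent `a` by `ℓ a`. -/
noncomputable def logDeriv (ℓ : Γ →+ K) : Derivation K (HahnSeries Γ K) (HahnSeries Γ K) :=
  Derivation.mk'
    { toFun := fun x => ⟨fun a => ℓ a * x.coeff a,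
        x.isPWO_support.mono fun a ha => right_ne_zero_of_mul ha⟩
      map_add' := fun x y => by ext a; simp [mul_add]
      map_smul' := fun c x => by ext a; simp [mul_left_comm] }
    fun x y => by
      ext a
      have h1 : ∀ z : HahnSeries Γ K, (⟨fun a => ℓ a * z.coeff a,
          z.isPWO_support.mono fun a ha => right_ne_zero_of_mul ha⟩ :
            HahnSeries Γ K).support ⊆ z.support := fun z a ha => right_ne_zero_of_mul ha
      simp only [LinearMap.coe_mk, AddHom.coe_mk, smul_eq_mul, coeff_add]
      rw [mul_comm y, coeff_mul_right' y.isPWO_support (h1 y),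
        coeff_mul_left' x.isPWO_support (h1 x), coeff_mul, Finset.mul_sum,
        ← Finset.sum_add_distrib]
      refine Finset.sum_congr rfl fun p hp => ?_
      rw [← (Finset.mem_antidiagonal.1 hp).2.2, map_add]
      ring

@[simp]
theorem coeff_logDeriv (ℓ : Γ →+ K) (x : HahnSeries Γ K) (a : Γ) :
    (logDeriv ℓ x).coeff a = ℓ a * x.coeff a := rfl

/-- The automorphism multiplying the monomial of exponent `a` by `χ a`. -/
noncomputable def twist (χ : Γ →+ Additive Kˣ) : HahnSeries Γ K →+* HahnSeries Γ K where
  toFun x := ⟨fun a => ((χ a).toMul : K) * x.coeff a,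
    x.isPWO_support.mono fun _ ha => right_ne_zero_of_mul ha⟩
  map_zero' := by ext; simp
  map_one' := by
    ext a
    by_cases h : a = 0 <;> simp [coeff_one, h]
  map_add' x y := by ext; simp [mul_add]
  map_mul' x y := by
    ext a
    have h1 : ∀ z : HahnSeries Γ K, (⟨fun a => ((χ a).toMul : K) * z.coeff a,
        z.isPWO_support.mono fun a ha => right_ne_zero_of_mul ha⟩ :
          HahnSeries Γ K).support = z.support := fun z => by ext; simp
    simp only [coeff_mul, Finset.mul_sum]
    refine Finset.sum_congr (by simp only [h1]) fun p hp => ?_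
    simp only [h1] at hp
    rw [← (Finset.mem_antidiagonal.1 hp).2.2, map_add, toMul_add, Units.val_mul]
    ring

@[simp]
theorem coeff_twist (χ : Γ →+ Additive Kˣ) (x : HahnSeries Γ K) (a : Γ) :
    (twist χ x).coeff a = ((χ a).toMul : K) * x.coeff a := rfl

/-- The Hahn series whose exponents lie in a submonoid. -/
noncomputable def supportedIn (K : Type*) [Field K] (M : AddSubmonoid Γ) :
    Subring (HahnSeries Γ K) where
  carrier := {x | ∀ a ∈ x.support, a ∈ M}
  zero_mem' := by simp
  one_mem' := by
    intro a ha
    rw [support_one, Set.mem_singleton_iff] at ha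
    exact ha ▸ M.zero_mem
  add_mem' hx hy a ha := (support_add_subset _ _ ha).elim (hx a) (hy a)
  neg_mem' {x} hx a ha := hx a (support_neg (x := x) ▸ ha)
  mul_mem' hx hy a ha := by
    obtain ⟨b, hb, c, hc, rfl⟩ := support_mul_subset ha
    exact M.add_mem (hx b hb) (hy c hc)

end HahnSeries

/-! ### Weighted linear orders on the exponents. -/

namespace QuasiOrdinary

/-- `ℚ^d` with the linear order comparing first the values of `w`, then lexicographically. -/
def Weighted {d : ℕ} (_ : (Fin d → ℚ) →+o ℚ) : Type := Fin d → ℚ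

namespace Weighted

variable {d : ℕ} (w : (Fin d → ℚ) →+o ℚ)

instance : AddCommGroup (Weighted w) := inferInstanceAs (AddCommGroup (Fin d → ℚ))

/-- The identity `ℚ^d → ℚ^d`. -/
noncomputable def of : (Fin d → ℚ) ≃+ Weighted w := AddEquiv.refl _

/-- The weight, followed by the exponent, in a lexicographic product. -/
noncomputable def toProd : Weighted w →+ ℚ ×ₗ Lex (Fin d → ℚ) where
  toFun a := toLex (w ((of w).symm a), toLex ((of w).symm a))
  map_zero' := by simp
  map_add' a b := by simp; rfl

theorem toProd_injective : Function.Injective (toProd w) := fun a b h => by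
  have := congrArg (fun p : ℚ ×ₗ Lex (Fin d → ℚ) => ofLex (ofLex p).2) h
  exact (of w).symm.injective this

noncomputable instance : LinearOrder (Weighted w) :=
  LinearOrder.lift' (toProd w) (toProd_injective w)

theorem le_iff {a b : Weighted w} : a ≤ b ↔ toProd w a ≤ toProd w b := Iff.rfl

instance : IsOrderedAddMonoid (Weighted w) where
  add_le_add_left a b h c := by
    rw [le_iff, map_add, map_add]
    have := (le_iff w).1 h
    gcongr

theorem monotone_of : Monotone (of w) := fun a b h => by
  rw [le_iff]
  exact Prod.Lex.toLex_mono (Prod.mk_le_mk.2 ⟨w.monotone' h, Pi.toLex_monotone h⟩)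

theorem weight_le {a b : Weighted w} (h : a ≤ b) : w ((of w).symm a) ≤ w ((of w).symm b) := by
  rcases Prod.Lex.le_iff.1 ((le_iff w).1 h) with h | h
  · exact h.le
  · exact h.1.le

theorem exists_nsmul_eq (n : ℕ) (hn : n ≠ 0) (γ : Weighted w) : ∃ δ : Weighted w, n • δ = γ := by
  refine ⟨of w ((n : ℚ)⁻¹ • (of w).symm γ), ?_⟩
  rw [← map_nsmul, ← Nat.cast_smul_eq_nsmul ℚ, smul_smul,
    mul_inv_cancel₀ (Nat.cast_ne_zero.2 hn), one_smul, AddEquiv.apply_symm_apply]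

end Weighted

/-- The field of Hahn series with respect to the weighted order. -/
abbrev WeightedSeries (K : Type*) [Field K] {d : ℕ} (w : (Fin d → ℚ) →+o ℚ) : Type _ :=
  HahnSeries (Weighted w) K

theorem isAlgClosed_weightedSeries (K : Type*) [Field K] [IsAlgClosed K] {d : ℕ}
    (w : (Fin d → ℚ) →+o ℚ) : IsAlgClosed (WeightedSeries K w) :=
  HahnSeries.isAlgClosed_of_divisible (Weighted.exists_nsmul_eq w)

variable {K : Type*} [Field K] {d : ℕ}

/-- The inclusion of the ambient ring into the field of series for the weighted order. -/
noncomputable def toWeighted (K : Type*) [Field K] {d : ℕ} (w : (Fin d → ℚ) →+o ℚ) :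
    Ambient K d →+* WeightedSeries K w :=
  HahnSeries.reorder (Weighted.of w) (Weighted.monotone_of w)

theorem coeff_toWeighted (w : (Fin d → ℚ) →+o ℚ) (x : Ambient K d) (a : Weighted w) :
    (toWeighted K w x).coeff a = x.coeff ((Weighted.of w).symm a) := rfl

theorem toWeighted_injective (w : (Fin d → ℚ) →+o ℚ) : Function.Injective (toWeighted K w) :=
  HahnSeries.reorder_injective _ _

instance : IsDomain (Ambient K d) :=
  (toWeighted_injective (K := K) (0 : (Fin d → ℚ) →+o ℚ)).isDomain _

/-- The inclusion of `K[[X₁,…,X_d]]` into the field of series for the weighted order. -/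
noncomputable def inclWeighted (K : Type*) [Field K] {d : ℕ} (w : (Fin d → ℚ) →+o ℚ) :
    MvPowerSeries (Fin d) K →+* WeightedSeries K w :=
  (toWeighted K w).comp (incl K d)

theorem coeff_incl_expHom (r : MvPowerSeries (Fin d) K) (m : Fin d →₀ ℕ) :
    (incl K d r).coeff (expHom d m) = MvPowerSeries.coeff m r := by
  have : (incl K d r).coeff (expHom d m) = (HahnSeries.toMvPowerSeries.symm r).coeff m :=
    HahnSeries.embDomain_mk_coeff (expHom_injective d) (fun _ _ => expHom_le_iff d _ _)
  rw [this, HahnSeries.coeff_toMvPowerSeries_symm]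

theorem coeff_incl_of_notMem_range (r : MvPowerSeries (Fin d) K) {a : Fin d → ℚ}
    (ha : a ∉ Set.range (expHom d)) : (incl K d r).coeff a = 0 :=
  HahnSeries.embDomain_of_notMem_range ha

theorem incl_injective : Function.Injective (incl K d) := fun r s h => by
  ext m
  rw [← coeff_incl_expHom, h, coeff_incl_expHom]

theorem inclWeighted_injective (w : (Fin d → ℚ) →+o ℚ) : Function.Injective (inclWeighted K w) :=
  (toWeighted_injective w).comp incl_injective

theorem incl_monomial (m : Fin d →₀ ℕ) (c : K) :
    incl K d (MvPowerSeries.monomial m c) = HahnSeries.single (expHom d m) c := by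
  classical
  ext a
  by_cases ha : a ∈ Set.range (expHom d)
  · obtain ⟨n, rfl⟩ := ha
    rw [coeff_incl_expHom, MvPowerSeries.coeff_monomial, HahnSeries.coeff_single]
    simp [(expHom_injective d).eq_iff]
  · rw [coeff_incl_of_notMem_range _ ha, HahnSeries.coeff_single_of_ne]
    rintro rfl
    exact ha ⟨m, rfl⟩

theorem toWeighted_single (w : (Fin d → ℚ) →+o ℚ) (a : Fin d → ℚ) (c : K) :
    toWeighted K w (HahnSeries.single a c) = HahnSeries.single (Weighted.of w a) c := by
  ext b
  rw [coeff_toWeighted, HahnSeries.coeff_single, HahnSeries.coeff_single]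
  simp [AddEquiv.symm_apply_eq]

theorem inclWeighted_monomial (w : (Fin d → ℚ) →+o ℚ) (m : Fin d →₀ ℕ) (c : K) :
    inclWeighted K w (MvPowerSeries.monomial m c) =
      HahnSeries.single (Weighted.of w (expHom d m)) c := by
  rw [inclWeighted, RingHom.comp_apply, incl_monomial, toWeighted_single]

/-- The `j`-th coordinate. -/
noncomputable def coordWeight {d : ℕ} (j : Fin d) : (Fin d → ℚ) →+o ℚ where
  toFun a := a j
  map_zero' := rfl
  map_add' _ _ := rfl
  monotone' _ _ h := h j

@[simp]
theorem coordWeight_apply (j : Fin d) (a : Fin d → ℚ) : coordWeight j a = a j := rfl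

end QuasiOrdinary

/-! ### Roots in the weighted fields: nonnegative weight and bounded denominators. -/

namespace QuasiOrdinary

open HahnSeries

theorem expHom_nonneg {d : ℕ} (m : Fin d →₀ ℕ) : 0 ≤ expHom d m := fun i => by
  simp [expHom]

section

variable {K : Type*} [Field K] {d : ℕ}

/-- The exponents of nonnegative weight. -/
noncomputable def nonnegWeight (w : (Fin d → ℚ) →+o ℚ) : AddSubmonoid (Weighted w) where
  carrier := {a | 0 ≤ w ((Weighted.of w).symm a)}
  zero_mem' := by simp
  add_mem' {a b} ha hb := by
    simp only [Set.mem_ofPred_eq, map_add] at *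
    positivity

theorem mem_nonnegWeight {w : (Fin d → ℚ) →+o ℚ} {a : Weighted w} :
    a ∈ nonnegWeight w ↔ 0 ≤ w ((Weighted.of w).symm a) := Iff.rfl

theorem exists_expHom_of_mem_support_incl {r : MvPowerSeries (Fin d) K} {a : Fin d → ℚ}
    (ha : a ∈ (incl K d r).support) : ∃ m, a = expHom d m := by
  by_contra! h
  exact ha (coeff_incl_of_notMem_range r (by rintro ⟨m, rfl⟩; exact h m rfl))

theorem exists_expHom_of_mem_support_inclWeighted {w : (Fin d → ℚ) →+o ℚ}
    {r : MvPowerSeries (Fin d) K} {a : Weighted w} (ha : a ∈ (inclWeighted K w r).support) :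
    ∃ m, a = Weighted.of w (expHom d m) := by
  obtain ⟨m, hm⟩ := exists_expHom_of_mem_support_incl (r := r) (a := (Weighted.of w).symm a) ha
  exact ⟨m, by rw [← hm, AddEquiv.apply_symm_apply]⟩

theorem inclWeighted_mem_supportedIn (w : (Fin d → ℚ) →+o ℚ) (r : MvPowerSeries (Fin d) K) :
    inclWeighted K w r ∈ supportedIn K (nonnegWeight w) := fun a ha => by
  obtain ⟨m, rfl⟩ := exists_expHom_of_mem_support_inclWeighted ha
  rw [mem_nonnegWeight, AddEquiv.symm_apply_apply]
  simpa using w.monotone' (expHom_nonneg m)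

/-- A root of a monic polynomial over the power series has only exponents of nonnegative weight. -/
theorem mem_supportedIn_of_eval₂_eq_zero {w : (Fin d → ℚ) →+o ℚ} {f : (MvPowerSeries (Fin d) K)[X]}
    (hf : f.Monic) {y : WeightedSeries K w} (hy : f.eval₂ (inclWeighted K w) y = 0) :
    y ∈ supportedIn K (nonnegWeight w) := by
  intro a ha
  have hy0 : y ≠ 0 := fun h => by simp [h] at ha
  rw [mem_nonnegWeight]
  refine le_trans ?_ (Weighted.weight_le w (order_le_of_coeff_ne_zero ha))
  set γ := y.order with hγ
  by_contra! hneg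
  rw [eval₂_eq_sum_range, Finset.sum_range_succ, hf.coeff_natDegree, map_one, one_mul] at hy
  set n := f.natDegree
  have hlead : (y ^ n).coeff (n • γ) ≠ 0 := by
    rw [hγ, ← order_pow, ne_eq, coeff_order_eq_zero]
    exact pow_ne_zero n hy0
  have hc := congrArg (fun s : WeightedSeries K w => s.coeff (n • γ)) hy
  simp only [HahnSeries.coeff_add, HahnSeries.coeff_zero, HahnSeries.coeff_sum] at hc
  -- The leading term of `y ^ n` must cancel against some term of degree `k < n`. That term has
  -- weight at least `k` times that of `γ`, which exceeds `n` times it if the weight of `γ` is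
  -- negative.
  obtain ⟨k, hk, hne⟩ := Finset.exists_ne_zero_of_sum_ne_zero
    (fun h0 => hlead (by rwa [h0, zero_add] at hc))
  obtain ⟨b, hb, c, hcs, hbc⟩ := support_mul_subset hne
  have h1 : 0 ≤ w ((Weighted.of w).symm b) := inclWeighted_mem_supportedIn w _ b hb
  have h2 : w ((Weighted.of w).symm (k • γ)) ≤ w ((Weighted.of w).symm c) := by
    refine Weighted.weight_le w ?_
    rw [hγ, ← order_pow]
    exact order_le_of_coeff_ne_zero hcs
  have h3 := congrArg (fun s => w ((Weighted.of w).symm s)) hbc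
  have hsmul : ∀ m : ℕ, w ((Weighted.of w).symm (m • γ)) = m * w ((Weighted.of w).symm γ) :=
    fun m => by rw [map_nsmul, map_nsmul, nsmul_eq_mul]
  simp only [map_add, hsmul] at h2 h3
  have h4 : (k : ℚ) < n := by exact_mod_cast Finset.mem_range.1 hk
  nlinarith

/-- The roots of `f` in the field of series for the weighted order. -/
noncomputable def weightedRoots (w : (Fin d → ℚ) →+o ℚ) (f : (MvPowerSeries (Fin d) K)[X]) :
    Set (WeightedSeries K w) :=
  {y | f.eval₂ (inclWeighted K w) y = 0}

theorem mem_weightedRoots_iff {w : (Fin d → ℚ) →+o ℚ} {f : (MvPowerSeries (Fin d) K)[X]}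
    (hf : f.Monic) {y : WeightedSeries K w} :
    y ∈ weightedRoots w f ↔ y ∈ (f.map (inclWeighted K w)).roots := by
  rw [mem_roots (hf.map _).ne_zero, IsRoot.def, eval_map]; rfl

theorem weightedRoots_finite (w : (Fin d → ℚ) →+o ℚ) {f : (MvPowerSeries (Fin d) K)[X]}
    (hf : f.Monic) : (weightedRoots w f).Finite := by
  classical
  refine ((f.map (inclWeighted K w)).roots.toFinset.finite_toSet).subset fun y hy => ?_
  simpa using (mem_weightedRoots_iff hf).1 hy

theorem ncard_weightedRoots_le (w : (Fin d → ℚ) →+o ℚ) {f : (MvPowerSeries (Fin d) K)[X]}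
    (hf : f.Monic) : (weightedRoots w f).ncard ≤ f.natDegree := by
  classical
  have : weightedRoots w f = ((f.map (inclWeighted K w)).roots.toFinset : Set _) := by
    ext y; simp only [Finset.mem_coe, Multiset.mem_toFinset]; exact mem_weightedRoots_iff hf
  rw [this, Set.ncard_coe_finset]
  exact (Multiset.toFinset_card_le _).trans ((card_roots' _).trans (natDegree_map_le))

theorem twist_inclWeighted {w : (Fin d → ℚ) →+o ℚ} {χ : Weighted w →+ Additive Kˣ}
    (hχ : ∀ m, χ (Weighted.of w (expHom d m)) = 0) (r : MvPowerSeries (Fin d) K) :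
    twist χ (inclWeighted K w r) = inclWeighted K w r := by
  ext a
  rw [coeff_twist]
  by_cases ha : a ∈ (inclWeighted K w r).support
  · obtain ⟨m, rfl⟩ := exists_expHom_of_mem_support_inclWeighted ha
    rw [hχ]; simp
  · rw [mem_support, not_not] at ha
    rw [ha, mul_zero]

/-- Characters trivial on integer exponents act as Galois automorphisms: they fix the coefficients
of `f`, hence preserve its roots. -/
theorem twist_mem_weightedRoots {w : (Fin d → ℚ) →+o ℚ} {χ : Weighted w →+ Additive Kˣ}
    (hχ : ∀ m, χ (Weighted.of w (expHom d m)) = 0) {f : (MvPowerSeries (Fin d) K)[X]}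
    {y : WeightedSeries K w} (hy : y ∈ weightedRoots w f) : twist χ y ∈ weightedRoots w f := by
  have h := congrArg (twist χ) (show f.eval₂ (inclWeighted K w) y = 0 from hy)
  rw [hom_eval₂, map_zero] at h
  rwa [show (twist χ).comp (inclWeighted K w) = inclWeighted K w from
    RingHom.ext (twist_inclWeighted hχ)] at h

/-- The unit group of an algebraically closed field is divisible, hence an injective `ℤ`-module. -/
theorem exists_addMonoidHom_extension [IsAlgClosed K] {M N : Type*} [AddCommGroup M]
    [AddCommGroup N] (i : M →+ N) (hi : Function.Injective i) (g : M →+ Additive Kˣ) :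
    ∃ h : N →+ Additive Kˣ, h.comp i = g := by
  have hdiv : ∀ (n : ℤ) (_ : n ≠ 0) (u : Additive Kˣ), ∃ v, n • v = u := by
    have hnat : ∀ (n : ℕ) (_ : n ≠ 0) (u : Additive Kˣ), ∃ v : Additive Kˣ, n • v = u := by
      intro n hn u
      obtain ⟨z, hz⟩ := IsAlgClosed.exists_pow_nat_eq (u.toMul : K) (Nat.pos_of_ne_zero hn)
      have hz0 : z ≠ 0 := by
        rintro rfl
        rw [zero_pow hn] at hz
        exact u.toMul.ne_zero hz.symm
      refine ⟨Additive.ofMul (Units.mk0 z hz0), ?_⟩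
      apply Additive.toMul.injective
      ext
      simpa using hz
    intro n hn u
    obtain ⟨v, hv⟩ := hnat n.natAbs (by simpa using hn) u
    rcases n.natAbs_eq with h | h
    · exact ⟨v, by rw [h, natCast_zsmul, hv]⟩
    · exact ⟨-v, by rw [h, neg_smul, smul_neg, neg_neg, natCast_zsmul, hv]⟩
  let : DivisibleBy (Additive Kˣ) ℤ :=
    divisibleByOfSMulRightSurj _ _ fun {n} hn u => hdiv n hn u
  exact (Module.Baer.of_divisible _).extension_property_addMonoidHom i hi g

/-- The denominators of the exponents of a root are at most the degree. -/
theorem den_le_natDegree [IsAlgClosed K] [CharZero K] {w : (Fin d → ℚ) →+o ℚ}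
    {f : (MvPowerSeries (Fin d) K)[X]} (hf : f.Monic) {y : WeightedSeries K w}
    (hy : y ∈ weightedRoots w f) {a : Weighted w} (ha : a ∈ y.support) (j : Fin d) :
    ((Weighted.of w).symm a j).den ≤ f.natDegree := by
  classical
  set q := (Weighted.of w).symm a j with hq
  set N := q.den with hN
  have hN0 : N ≠ 0 := q.den_nz
  have : NeZero (N : K) := ⟨Nat.cast_ne_zero.2 hN0⟩
  have : NeZero N := ⟨hN0⟩
  obtain ⟨ζ, hζ⟩ := HasEnoughRootsOfUnity.exists_primitiveRoot K N
  obtain ⟨u, rfl⟩ := hζ.isUnit hN0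
  have hu : IsPrimitiveRoot u N := IsPrimitiveRoot.coe_units_iff.1 hζ
  -- The character `ψ` of `ℚ` sends `1 / N` to a primitive `N`-th root of unity, so it is trivial on
  -- the integers while `ψ q` is again primitive, `q` having denominator `N`.
  obtain ⟨ψ, hψ⟩ := exists_addMonoidHom_extension (K := K)
    ((AddMonoidHom.mulRight ((N : ℚ)⁻¹)).comp (Int.castAddHom ℚ))
    (fun a b h => by simpa [hN0] using h) (zmultiplesHom _ (Additive.ofMul u))
  have hψz : ∀ z : ℤ, ψ (z * (N : ℚ)⁻¹) = z • Additive.ofMul u := fun z => by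
    simpa using DFunLike.congr_fun hψ z
  have hψq : ψ q = q.num • Additive.ofMul u := by
    rw [← hψz, ← div_eq_mul_inv, Rat.num_div_den]
  have hψn : ∀ n : ℕ, ψ n = 0 := fun n => by
    have : ((n : ℕ) : ℚ) = ((n * N : ℤ) : ℚ) * (N : ℚ)⁻¹ := by
      push_cast; rw [mul_assoc, mul_inv_cancel₀ (Nat.cast_ne_zero.2 hN0), mul_one]
    rw [this, hψz, mul_smul, natCast_zsmul _ N, ← ofMul_pow, hu.pow_eq_one, ofMul_one, smul_zero]
  let χ : Weighted w →+ Additive Kˣ :=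
    ψ.comp ((Pi.evalAddMonoidHom (fun _ : Fin d => ℚ) j).comp (Weighted.of w).symm.toAddMonoidHom)
  have hχ : ∀ (k : ℕ) (m : Fin d →₀ ℕ), (k • χ) (Weighted.of w (expHom d m)) = 0 := fun k m => by
    have : χ (Weighted.of w (expHom d m)) = ψ (m j : ℚ) := rfl
    rw [AddMonoidHom.nsmul_apply, this, hψn, smul_zero]
  -- The twists of `y` by the multiples `k • χ`, `k < N`, already differ in the coefficient at `a`.
  have hcard : (Finset.range N).card ≤ (weightedRoots w f).ncard := by
    rw [← Set.ncard_coe_finset]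
    refine Set.ncard_le_ncard_of_injOn (fun k => twist (k • χ) y)
      (fun k _ => twist_mem_weightedRoots (hχ k) hy) ?_ (weightedRoots_finite w hf)
    intro k hk l hl hkl
    have h1 := congrArg (fun s : WeightedSeries K w => s.coeff a) hkl
    simp only [coeff_twist] at h1
    have h2 := mul_right_cancel₀ ha h1
    have h3 : χ a = q.num • Additive.ofMul u := hψq
    simp only [AddMonoidHom.nsmul_apply, h3, toMul_nsmul, toMul_zsmul, toMul_ofMul,
      Units.val_inj] at h2
    have hprim : IsPrimitiveRoot (u ^ q.num) N := hu.zpow_of_gcd_eq_one _ (by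
      rw [Int.gcd]; simpa [hN] using q.reduced)
    exact hprim.pow_inj (by simpa using hk) (by simpa using hl) h2
  rw [Finset.card_range] at hcard
  exact hcard.trans (ncard_weightedRoots_le w hf)

/-- The factorial of the degree is a common multiple of all the denominators allowed by
`den_le_natDegree`. -/
theorem exists_int_factorial_mul [IsAlgClosed K] [CharZero K] {w : (Fin d → ℚ) →+o ℚ}
    {f : (MvPowerSeries (Fin d) K)[X]} (hf : f.Monic) {y : WeightedSeries K w}
    (hy : y ∈ weightedRoots w f) {a : Weighted w} (ha : a ∈ y.support) (j : Fin d) :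
    ∃ z : ℤ, (Weighted.of w).symm a j * (f.natDegree.factorial : ℚ) = z := by
  obtain ⟨c, hc⟩ := Nat.dvd_factorial (Rat.den_pos _) (den_le_natDegree hf hy ha j)
  refine ⟨((Weighted.of w).symm a j).num * c, ?_⟩
  rw [hc]
  push_cast
  rw [← mul_assoc, Rat.mul_den_eq_num]

end

end QuasiOrdinary

/-! ### The discriminant and rational families of functions of the roots. -/

namespace Polynomial

/-- The discriminant of a monic polynomial of positive degree is a combination of the polynomial and
its derivative. -/
theorem Monic.exists_mul_add_derivative_mul_eq_C_discr {R : Type*} [CommRing R] {f : R[X]}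
    (hf : f.Monic) (hdeg : 0 < f.natDegree) :
    ∃ p q, f * p + derivative f * q = C f.discr := by
  obtain ⟨p, q, -, -, h⟩ := exists_mul_add_mul_eq_C_resultant f (derivative f)
    (m := f.natDegree) (n := f.natDegree - 1) le_rfl (natDegree_derivative_le f) (Or.inl hdeg.ne')
  rw [resultant_deriv (natDegree_pos_iff_degree_pos.1 hdeg), hf.leadingCoeff, mul_one] at h
  set s : R := (-1) ^ (f.natDegree * (f.natDegree - 1) / 2) with hs
  have hs2 : s * s = 1 := by rw [hs, ← mul_pow]; simp
  refine ⟨C s * p, C s * q, ?_⟩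
  calc f * (C s * p) + derivative f * (C s * q) = C s * (f * p + derivative f * q) := by ring
    _ = C f.discr := by rw [h, ← C_mul, ← mul_assoc, hs2, one_mul]

end Polynomial

namespace QuasiOrdinary

open HahnSeries

variable {K : Type*} [Field K] {d : ℕ}

/-- The `i`-th exponent, as an element of the coefficient field. -/
noncomputable def coordHom (K : Type*) [Field K] [CharZero K] {d : ℕ} (w : (Fin d → ℚ) →+o ℚ)
    (i : Fin d) : Weighted w →+ K :=
  (Rat.castHom K).toAddMonoidHom.comp
    ((Pi.evalAddMonoidHom (fun _ : Fin d => ℚ) i).comp (Weighted.of w).symm.toAddMonoidHom)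

section

variable [CharZero K]

theorem coordHom_apply (w : (Fin d → ℚ) →+o ℚ) (i : Fin d) (a : Weighted w) :
    coordHom K w i a = (((Weighted.of w).symm a i : ℚ) : K) := rfl

theorem exists_logDeriv_inclWeighted (i : Fin d) (r : MvPowerSeries (Fin d) K) :
    ∃ s : MvPowerSeries (Fin d) K, ∀ w : (Fin d → ℚ) →+o ℚ,
      inclWeighted K w s = logDeriv (coordHom K w i) (inclWeighted K w r) := by
  obtain ⟨s, hs⟩ : ∃ s : MvPowerSeries (Fin d) K, ∀ m,
      MvPowerSeries.coeff m s = (m i : K) * MvPowerSeries.coeff m r :=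
    ⟨fun m => (m i : K) * MvPowerSeries.coeff m r, fun _ => rfl⟩
  refine ⟨s, fun w => ?_⟩
  ext a
  rw [coeff_logDeriv, inclWeighted, RingHom.comp_apply, RingHom.comp_apply, coeff_toWeighted,
    coeff_toWeighted, coordHom_apply]
  by_cases ha : (Weighted.of w).symm a ∈ Set.range (expHom d)
  · obtain ⟨m, hm⟩ := ha
    rw [← hm, coeff_incl_expHom, coeff_incl_expHom, hs]
    simp [expHom]
  · rw [coeff_incl_of_notMem_range _ ha, coeff_incl_of_notMem_range _ ha, mul_zero]

/-- Chain rule, with `q` obtained by differentiating the coefficients of `p`. It matters that `q` is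
chosen before the weight: the same identity holds in all the fields. -/
theorem exists_logDeriv_eval₂ (i : Fin d) (p : (MvPowerSeries (Fin d) K)[X]) :
    ∃ q : (MvPowerSeries (Fin d) K)[X], ∀ (w : (Fin d → ℚ) →+o ℚ) (y : WeightedSeries K w),
      logDeriv (coordHom K w i) (p.eval₂ (inclWeighted K w) y) =
        q.eval₂ (inclWeighted K w) y +
          (derivative p).eval₂ (inclWeighted K w) y * logDeriv (coordHom K w i) y := by
  induction p using Polynomial.induction_on' with
  | add p p' hp hp' =>
    obtain ⟨q, hq⟩ := hp
    obtain ⟨q', hq'⟩ := hp'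
    refine ⟨q + q', fun w y => ?_⟩
    rw [eval₂_add, map_add, hq, hq', eval₂_add, derivative_add, eval₂_add]
    ring
  | monomial k r =>
    obtain ⟨s, hs⟩ := exists_logDeriv_inclWeighted i r
    refine ⟨monomial k s, fun w y => ?_⟩
    rw [eval₂_monomial, eval₂_monomial, derivative_monomial, eval₂_monomial, Derivation.leibniz,
      Derivation.leibniz_pow, hs, map_mul, map_natCast]
    simp only [smul_eq_mul, nsmul_eq_mul]
    ring

end

/-- The family `a` of functions of the roots `y` of `f` in the various fields of weighted series is
given by a polynomial in `y`, up to a monomial denominator. -/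
def IsRationalFamily (f : (MvPowerSeries (Fin d) K)[X])
    (a : ∀ w : (Fin d → ℚ) →+o ℚ, WeightedSeries K w → WeightedSeries K w) : Prop :=
  ∃ (β : Fin d →₀ ℕ) (p : (MvPowerSeries (Fin d) K)[X]), ∀ w, ∀ y ∈ weightedRoots w f,
    inclWeighted K w (MvPowerSeries.monomial β 1) * a w y = p.eval₂ (inclWeighted K w) y

namespace IsRationalFamily

variable {f : (MvPowerSeries (Fin d) K)[X]}
  {a : ∀ w : (Fin d → ℚ) →+o ℚ, WeightedSeries K w → WeightedSeries K w}

theorem root (f : (MvPowerSeries (Fin d) K)[X]) : IsRationalFamily f fun _ y => y :=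
  ⟨0, X, fun w y _ => by
    rw [eval₂_X, MvPowerSeries.monomial_zero_one, map_one, one_mul]⟩

theorem sub_smul {b : ∀ w : (Fin d → ℚ) →+o ℚ, WeightedSeries K w → WeightedSeries K w} (c : K)
    (hb : IsRationalFamily f b) (ha : IsRationalFamily f a) :
    IsRationalFamily f fun w y => b w y - c • a w y := by
  obtain ⟨β, p, hp⟩ := ha
  obtain ⟨γ, q, hq⟩ := hb
  refine ⟨β + γ, C (MvPowerSeries.monomial β 1) * q - C (MvPowerSeries.monomial γ c) * p,
    fun w y hy => ?_⟩
  beta_reduce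
  rw [eval₂_sub, eval₂_mul, eval₂_mul, eval₂_C, eval₂_C, ← hp w y hy, ← hq w y hy, ← C_mul_eq_smul]
  have h1 : (MvPowerSeries.monomial (β + γ) (1 : K)) =
      MvPowerSeries.monomial β 1 * MvPowerSeries.monomial γ 1 := by
    rw [MvPowerSeries.monomial_mul_monomial, one_mul]
  have h2 : inclWeighted K w (MvPowerSeries.monomial γ c) =
      inclWeighted K w (MvPowerSeries.monomial γ 1) * HahnSeries.C c := by
    rw [inclWeighted_monomial, inclWeighted_monomial, HahnSeries.C_apply,
      HahnSeries.single_mul_single, add_zero, one_mul]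
  rw [h1, h2, map_mul]
  ring

theorem mul_single_neg (β : Fin d →₀ ℕ) (ha : IsRationalFamily f a) :
    IsRationalFamily f fun w y => a w y * single (-Weighted.of w (expHom d β)) 1 := by
  obtain ⟨γ, p, hp⟩ := ha
  refine ⟨γ + β, p, fun w y hy => ?_⟩
  rw [← hp w y hy, inclWeighted_monomial, inclWeighted_monomial, mul_left_comm,
    HahnSeries.single_mul_single, mul_comm, map_add, map_add, add_neg_cancel_right, one_mul]

/-- Rational families are stable under the logarithmic derivations, because the discriminant is
a monomial times a unit. -/
theorem logDeriv [CharZero K] (hqo : IsQuasiOrdinary f) (hdeg : 0 < f.natDegree) (i : Fin d)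
    (ha : IsRationalFamily f a) :
    IsRationalFamily f fun w y => HahnSeries.logDeriv (coordHom K w i) (a w y) := by
  obtain ⟨hf, α, u, hu, hD⟩ := hqo
  obtain ⟨v, hv⟩ :=
    (MvPowerSeries.isUnit_iff_constantCoeff.2 (isUnit_iff_ne_zero.2 hu)).exists_left_inv
  obtain ⟨s, g, hfg⟩ := hf.exists_mul_add_derivative_mul_eq_C_discr hdeg
  obtain ⟨β, p, hp⟩ := ha
  obtain ⟨q, hq⟩ := exists_logDeriv_eval₂ i p
  obtain ⟨q₀, hq₀⟩ := exists_logDeriv_eval₂ i f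
  set A : MvPowerSeries (Fin d) K := MvPowerSeries.monomial α 1 with hA
  -- Differentiate `X^β a = p(y)`, using that `θ_i` multiplies `X^β` by `β i`, and replace `X^α θ_i
  -- y` by its polynomial expression `e6`.
  refine ⟨α + β, C A * (q - (β i : (MvPowerSeries (Fin d) K)[X]) * p) -
      derivative p * (C v * g * q₀),
    fun w y hy => ?_⟩
  have h1 : (MvPowerSeries.monomial (α + β) (1 : K)) =
      MvPowerSeries.monomial α 1 * MvPowerSeries.monomial β 1 := by
    rw [MvPowerSeries.monomial_mul_monomial, one_mul]
  have hy0 : f.eval₂ (inclWeighted K w) y = 0 := hy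
  have e1 := congrArg (HahnSeries.logDeriv (coordHom K w i)) (hp w y hy)
  rw [hq, Derivation.leibniz, smul_eq_mul, smul_eq_mul] at e1
  have e2 : HahnSeries.logDeriv (coordHom K w i) (inclWeighted K w (MvPowerSeries.monomial β 1)) =
      (β i : WeightedSeries K w) * inclWeighted K w (MvPowerSeries.monomial β 1) := by
    rw [inclWeighted_monomial]
    ext b
    rw [coeff_logDeriv, ← nsmul_eq_mul, coeff_nsmul, Pi.smul_apply, nsmul_eq_mul]
    by_cases hb : b = Weighted.of w (expHom d β)
    · subst hb
      simp [coordHom_apply, expHom]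
    · rw [coeff_single_of_ne hb, mul_zero, mul_zero]
  have e3 := hq₀ w y
  rw [hy0, map_zero] at e3
  have e4 := congrArg (eval₂ (inclWeighted K w) y) hfg
  rw [eval₂_add, eval₂_mul, eval₂_mul, hy0, zero_mul, zero_add, eval₂_C, hD, map_mul] at e4
  have e5 : inclWeighted K w v * inclWeighted K w u = 1 := by rw [← map_mul, hv, map_one]
  -- Implicit differentiation of `f(y) = 0` gives `f'(y) θ_i y = -q₀(y)`. Multiplying by `v g(y)`
  -- leaves `X^α` on the left, because `f'(y) g(y) = X^α u` and `v u = 1`.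
  have e6 : inclWeighted K w A * HahnSeries.logDeriv (coordHom K w i) y =
      -(inclWeighted K w v * g.eval₂ (inclWeighted K w) y * q₀.eval₂ (inclWeighted K w) y) := by
    linear_combination (inclWeighted K w v * g.eval₂ (inclWeighted K w) y) * (-e3) -
      inclWeighted K w v * HahnSeries.logDeriv (coordHom K w i) y * (e4) -
      inclWeighted K w A * HahnSeries.logDeriv (coordHom K w i) y * e5
  rw [h1, map_mul]
  simp only [eval₂_sub, eval₂_mul, eval₂_C, eval₂_natCast]
  rw [e2] at e1
  have e7 := hp w y hy
  linear_combination inclWeighted K w A * e1 -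
    inclWeighted K w A * (β i : WeightedSeries K w) * e7 +
    (derivative p).eval₂ (inclWeighted K w) y * e6

end IsRationalFamily

end QuasiOrdinary

/-! ### Lagrange interpolation and integrality of rational families. -/

namespace Polynomial

/-- Lagrange interpolation at the roots of a monic polynomial: the coefficients of `D • P`, where
`F' G ≡ D mod F`, in terms of the values of `P` at the roots. -/
theorem mul_coeff_eq_sum_of_roots {L : Type*} [Field L] {F G P : L[X]} {D : L} {s : Finset L}
    (hF : F.Monic) (hs : ∀ y ∈ s, F.eval y = 0) (hcard : s.card = F.natDegree)
    (hP : P.degree < F.degree) (hG : ∀ y ∈ s, (derivative F).eval y * G.eval y = D) (k : ℕ) :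
    D * P.coeff k = ∑ y ∈ s, P.eval y * (G.eval y * (F /ₘ (X - C y)).coeff k) := by
  have hFdeg : F.degree = (s.card : WithBot ℕ) := by
    rw [hcard, degree_eq_natDegree hF.ne_zero]
  have hfac : ∀ y ∈ s, (X - C y) * (F /ₘ (X - C y)) = F := fun y hy =>
    mul_divByMonic_eq_iff_isRoot.2 (hs y hy)
  -- Both sides have degree below the number of points of `s`. At a point `z` only its own summand
  -- survives, since `F / (X - z)` takes the value `F'(z)` there.
  have key : C D * P = ∑ y ∈ s, C (P.eval y * G.eval y) * (F /ₘ (X - C y)) := by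
    refine eq_of_degrees_lt_of_eval_finset_eq s ?_ ?_ fun z hz => ?_
    · rw [← hFdeg]
      exact (degree_mul_le _ _).trans_lt
        ((add_le_add_left degree_C_le _).trans_lt (by rwa [zero_add]))
    · refine (degree_sum_le _ _).trans_lt ?_
      rw [Finset.sup_lt_iff (by rw [bot_lt_iff_ne_bot]; simp)]
      intro y hy
      refine (degree_mul_le _ _).trans_lt
        ((add_le_add_left degree_C_le _).trans_lt ?_)
      rw [zero_add, ← hFdeg]
      refine degree_divByMonic_lt _ _ hF.ne_zero ?_
      rw [degree_X_sub_C]; exact zero_lt_one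
    · rw [eval_mul, eval_C, eval_finsetSum, Finset.sum_eq_single z]
      · rw [eval_mul, eval_C]
        have h1 := congrArg (fun q => (derivative q).eval z) (hfac z hz)
        simp only [derivative_mul, derivative_sub, derivative_X, derivative_C, sub_zero, one_mul,
          eval_add, eval_mul, eval_sub, eval_X, eval_C, sub_self, zero_mul, add_zero] at h1
        rw [h1, ← hG z hz]; ring
      · intro y hy hyz
        have h1 := congrArg (eval z) (hfac y hy)
        rw [hs z hz, eval_mul, eval_sub, eval_X, eval_C] at h1
        rw [eval_mul, (mul_eq_zero.1 h1).resolve_left (sub_ne_zero.2 hyz.symm), mul_zero]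
      · exact fun h => absurd hz h
  have := congrArg (fun q => q.coeff k) key
  simp only [coeff_C_mul, finsetSum_coeff] at this
  rw [this]
  exact Finset.sum_congr rfl fun y _ => by ring

end Polynomial

namespace QuasiOrdinary

open HahnSeries

variable {K : Type*} [Field K] {d : ℕ}

theorem IsQuasiOrdinary.discr_ne_zero {f : (MvPowerSeries (Fin d) K)[X]}
    (hqo : IsQuasiOrdinary f) : f.discr ≠ 0 := by
  obtain ⟨-, α, u, hu, hD⟩ := hqo
  rw [hD]
  intro h
  have h1 := congrArg (MvPowerSeries.coeff α) h
  rw [MvPowerSeries.coeff_monomial_mul] at h1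
  simp at h1
  exact hu h1

/-- The nonzero discriminant becomes a unit in the weighted field, so `f` is separable there, and it
splits. -/
theorem ncard_weightedRoots [IsAlgClosed K] {f : (MvPowerSeries (Fin d) K)[X]}
    (hqo : IsQuasiOrdinary f) (hdeg : 0 < f.natDegree) (w : (Fin d → ℚ) →+o ℚ) :
    (weightedRoots w f).ncard = f.natDegree := by
  classical
  have := isAlgClosed_weightedSeries K w
  have hf := hqo.1
  obtain ⟨p, g, hfg⟩ := hf.exists_mul_add_derivative_mul_eq_C_discr hdeg
  set F := f.map (inclWeighted K w) with hF
  have hsep : F.Separable := by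
    have h1 := congrArg (Polynomial.map (inclWeighted K w)) hfg
    rw [Polynomial.map_add, Polynomial.map_mul, Polynomial.map_mul, ← derivative_map,
      Polynomial.map_C] at h1
    have hu : IsUnit (Polynomial.C (inclWeighted K w f.discr)) :=
      isUnit_C.2 (isUnit_iff_ne_zero.2 (by
        rw [ne_eq, map_eq_zero_iff _ (inclWeighted_injective w)]; exact hqo.discr_ne_zero))
    obtain ⟨v, hv⟩ := hu.exists_left_inv
    refine ⟨v * p.map (inclWeighted K w), v * g.map (inclWeighted K w), ?_⟩
    rw [← hv, ← h1]; ring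
  have hset : weightedRoots w f = (F.roots.toFinset : Set _) := by
    ext y; simp only [Finset.mem_coe, Multiset.mem_toFinset]; exact mem_weightedRoots_iff hf
  rw [hset, Set.ncard_coe_finset, Multiset.toFinset_card_of_nodup (nodup_roots hsep),
    ← (IsAlgClosed.splits F).natDegree_eq_card_roots, hF, hf.natDegree_map]

theorem eval₂_mem_supportedIn {w : (Fin d → ℚ) →+o ℚ} {y : WeightedSeries K w}
    (hy : y ∈ supportedIn K (nonnegWeight w)) (p : (MvPowerSeries (Fin d) K)[X]) :
    p.eval₂ (inclWeighted K w) y ∈ supportedIn K (nonnegWeight w) := by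
  rw [eval₂_eq_sum_range]
  exact Subring.sum_mem _ fun k _ => Subring.mul_mem _ (inclWeighted_mem_supportedIn w _)
    (Subring.pow_mem _ hy k)

/-- A rational family which takes values of nonnegative weight, for each coordinate weight, is given
by a polynomial with denominator the discriminant. -/
theorem IsRationalFamily.exists_discr_mul_eq [IsAlgClosed K] {f : (MvPowerSeries (Fin d) K)[X]}
    {a : ∀ w : (Fin d → ℚ) →+o ℚ, WeightedSeries K w → WeightedSeries K w}
    (hqo : IsQuasiOrdinary f) (hdeg : 0 < f.natDegree) (ha : IsRationalFamily f a)
    (hint : ∀ j, ∀ y ∈ weightedRoots (coordWeight j) f,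
      a _ y ∈ supportedIn K (nonnegWeight (coordWeight j))) :
    ∃ q : (MvPowerSeries (Fin d) K)[X], q.natDegree < f.natDegree ∧ ∀ w, ∀ y ∈ weightedRoots w f,
      inclWeighted K w f.discr * a w y = q.eval₂ (inclWeighted K w) y := by
  classical
  have hf := hqo.1
  obtain ⟨s, g, hfg⟩ := hf.exists_mul_add_derivative_mul_eq_C_discr hdeg
  obtain ⟨β, p₀, hp₀⟩ := ha
  set p := p₀ %ₘ f with hpdef
  have hp : ∀ w, ∀ y ∈ weightedRoots w f,
      inclWeighted K w (MvPowerSeries.monomial β 1) * a w y = p.eval₂ (inclWeighted K w) y :=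
    fun w y hy => by
      rw [hp₀ w y hy, hpdef, eval₂_modByMonic_eq_self_of_root hy]
  have hpdeg : p.natDegree < f.natDegree :=
    natDegree_modByMonic_lt _ hf (by rintro rfl; simp at hdeg)
  -- Divisibility of the coefficients by `X^β` is tested one coordinate `j` at a time, in the field
  -- of the `j`-th coordinate weight. Interpolation writes the coefficient as `X^β` times a sum of
  -- series of nonnegative weight, which excludes exponents `m` with `m j < β j`.
  have hdvd : ∀ k m, ¬ β ≤ m → MvPowerSeries.coeff m (f.discr * p.coeff k) = 0 := by
    intro k m hm
    rw [Finsupp.le_def] at hm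
    push Not at hm
    obtain ⟨j, hj⟩ := hm
    set w := coordWeight j with hw
    have hfin := weightedRoots_finite w hf
    have hF := hf.map (inclWeighted K w)
    have hmem : ∀ y ∈ hfin.toFinset, y ∈ weightedRoots w f := fun y hy => hfin.mem_toFinset.1 hy
    have hlag := mul_coeff_eq_sum_of_roots (F := f.map (inclWeighted K w))
      (G := g.map (inclWeighted K w)) (P := p.map (inclWeighted K w))
      (D := inclWeighted K w f.discr) (s := hfin.toFinset) hF
      (fun y hy => by rw [eval_map]; exact hmem y hy)
      (by rw [← Set.ncard_eq_toFinset_card _ hfin, ncard_weightedRoots hqo hdeg w,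
        hf.natDegree_map])
      (by
        rw [hf.degree_map]
        exact degree_map_le.trans_lt (degree_lt_degree hpdeg))
      (fun y hy => by
        have h1 := congrArg (eval₂ (inclWeighted K w) y) hfg
        have h2 : f.eval₂ (inclWeighted K w) y = 0 := hmem y hy
        rw [eval₂_add, eval₂_mul, eval₂_mul, h2, zero_mul, zero_add, eval₂_C] at h1
        rw [derivative_map, eval_map, eval_map, h1]) k
    have hmemO : ∃ t ∈ supportedIn K (nonnegWeight w), inclWeighted K w (f.discr * p.coeff k) =
        inclWeighted K w (MvPowerSeries.monomial β 1) * t := by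
      refine ⟨∑ y ∈ hfin.toFinset, a w y * (g.eval₂ (inclWeighted K w) y *
        (f.map (inclWeighted K w) /ₘ (X - Polynomial.C y)).coeff k), ?_, ?_⟩
      · refine Subring.sum_mem _ fun y hy => Subring.mul_mem _ (hint j y (hmem y hy)) ?_
        have hyO := mem_supportedIn_of_eval₂_eq_zero hf (hmem y hy)
        refine Subring.mul_mem _ (eval₂_mem_supportedIn hyO g) ?_
        rw [coeff_divByMonic_X_sub_C]
        exact Subring.sum_mem _ fun i _ => Subring.mul_mem _ (Subring.pow_mem _ hyO _)
          (by rw [coeff_map]; exact inclWeighted_mem_supportedIn w _)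
      · rw [coeff_map] at hlag
        rw [map_mul, hlag, Finset.mul_sum]
        refine Finset.sum_congr rfl fun y hy => ?_
        rw [eval_map, eval_map, ← hp w y (hmem y hy), mul_assoc]
    obtain ⟨t, ht, hteq⟩ := hmemO
    rw [inclWeighted_monomial] at hteq
    have hc := congrArg (fun x : WeightedSeries K w => x.coeff (Weighted.of w (expHom d m))) hteq
    simp only [coeff_single_mul, one_mul] at hc
    rw [inclWeighted, RingHom.comp_apply, coeff_toWeighted, AddEquiv.symm_apply_apply,
      coeff_incl_expHom] at hc
    rw [hc]
    by_contra hne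
    have h1 := ht _ hne
    rw [mem_nonnegWeight, map_sub, AddEquiv.symm_apply_apply, AddEquiv.symm_apply_apply, hw,
      coordWeight_apply] at h1
    simp only [Pi.sub_apply, expHom, AddMonoidHom.coe_mk, ZeroHom.coe_mk, sub_nonneg] at h1
    exact absurd (by exact_mod_cast h1) (not_le.2 hj)
  have hex : ∀ k, ∃ r, MvPowerSeries.monomial β 1 * r = f.discr * p.coeff k := by
    intro k
    obtain ⟨r, hr⟩ : ∃ r : MvPowerSeries (Fin d) K, ∀ m, MvPowerSeries.coeff m r =
        MvPowerSeries.coeff (m + β) (f.discr * p.coeff k) :=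
      ⟨fun m => MvPowerSeries.coeff (m + β) (f.discr * p.coeff k), fun _ => rfl⟩
    refine ⟨r, ?_⟩
    ext m
    rw [MvPowerSeries.coeff_monomial_mul]
    split_ifs with h
    · rw [hr, tsub_add_cancel_of_le h, one_mul]
    · exact (hdvd k m h).symm
  choose r hr using hex
  refine ⟨∑ k ∈ Finset.range f.natDegree, monomial k (r k), ?_, fun w y hy => ?_⟩
  · refine (natDegree_sum_le_of_forall_le (n := f.natDegree - 1) _ _ fun k hk => ?_).trans_lt
      (by omega)
    exact (natDegree_monomial_le _).trans (by have := Finset.mem_range.1 hk; omega)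
  · have hne : inclWeighted K w (MvPowerSeries.monomial β 1) ≠ 0 := by
      rw [inclWeighted_monomial]; exact single_ne_zero one_ne_zero
    apply mul_left_cancel₀ hne
    rw [mul_left_comm, hp w y hy, eval₂_eq_sum_range' _ hpdeg, eval₂_finsetSum, Finset.mul_sum,
      Finset.mul_sum]
    refine Finset.sum_congr rfl fun k _ => ?_
    rw [eval₂_monomial, ← mul_assoc, ← mul_assoc, ← map_mul, ← map_mul, hr]

end QuasiOrdinary

/-! ### The Abhyankar–Jung theorem. -/

namespace QuasiOrdinary

open HahnSeries

variable {K : Type*} [Field K] {d : ℕ}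

/-- The degree bound confines the exponents of all the values `q(y)` to `ℕ^d` plus one partially
well-ordered set that does not depend on `q`. -/
theorem exists_support_add_of_mem_support_eval₂ {w : (Fin d → ℚ) →+o ℚ} {n : ℕ}
    {q : (MvPowerSeries (Fin d) K)[X]} (hq : q.natDegree < n) {y : WeightedSeries K w}
    {a : Weighted w} (ha : a ∈ (q.eval₂ (inclWeighted K w) y).support) :
    ∃ m : Fin d →₀ ℕ, ∃ c ∈ ⋃ k ∈ Finset.range n, (y ^ k).support,
      a = Weighted.of w (expHom d m) + c := by
  rw [eval₂_eq_sum_range' _ hq, mem_support, HahnSeries.coeff_sum] at ha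
  obtain ⟨k, hk, hne⟩ := Finset.exists_ne_zero_of_sum_ne_zero ha
  obtain ⟨b, hb, c, hc, hbc⟩ := support_mul_subset hne
  obtain ⟨m, rfl⟩ := exists_expHom_of_mem_support_inclWeighted hb
  exact ⟨m, c, Set.mem_biUnion hk hc, hbc.symm⟩

theorem toWeighted_mem_weightedRoots {f : (MvPowerSeries (Fin d) K)[X]} (w : (Fin d → ℚ) →+o ℚ)
    {x : Ambient K d} (hx : x ∈ Zer f) : toWeighted K w x ∈ weightedRoots w f := by
  have h := congrArg (toWeighted K w) hx.2
  rwa [hom_eval₂, map_zero] at h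

section

variable [CharZero K]

/-- The iterated operator `∏_{i < N} (θ_j - i / e)` applied to `x`, where `θ_j` is the `j`-th
logarithmic derivation. -/
noncomputable def descend (j : Fin d) (e : ℕ) (w : (Fin d → ℚ) →+o ℚ) (x : WeightedSeries K w) :
    ℕ → WeightedSeries K w
  | 0 => x
  | N + 1 => logDeriv (coordHom K w j) (descend j e w x N) -
      (((N : ℚ) / e : ℚ) : K) • descend j e w x N

theorem coeff_descend (j : Fin d) (e : ℕ) (w : (Fin d → ℚ) →+o ℚ) (x : WeightedSeries K w) (N : ℕ)
    (a : Weighted w) :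
    (descend j e w x N).coeff a =
      ((∏ i ∈ Finset.range N, ((Weighted.of w).symm a j - (i : ℚ) / e) : ℚ) : K) * x.coeff a := by
  induction N with
  | zero => simp [descend]
  | succ N ih =>
    rw [descend, HahnSeries.coeff_sub, coeff_logDeriv, HahnSeries.coeff_smul, ih, smul_eq_mul,
      coordHom_apply,
      Finset.prod_range_succ]
    push_cast
    ring

theorem isRationalFamily_descend {f : (MvPowerSeries (Fin d) K)[X]} (hqo : IsQuasiOrdinary f)
    (hdeg : 0 < f.natDegree) (j : Fin d) (e N : ℕ) :
    IsRationalFamily f fun w y => descend j e w y N := by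
  induction N with
  | zero => exact IsRationalFamily.root f
  | succ N ih => exact (ih.logDeriv hqo hdeg j).sub_smul _ ih

/-- The values of `descend` at the roots are divisible by a high power of the variable, up to the
discriminant. -/
theorem exists_monomial_mul_descend_eq [IsAlgClosed K] {f : (MvPowerSeries (Fin d) K)[X]}
    (hqo : IsQuasiOrdinary f) (hdeg : 0 < f.natDegree) (j : Fin d) (M : ℕ) :
    ∃ q : (MvPowerSeries (Fin d) K)[X], q.natDegree < f.natDegree ∧ ∀ w, ∀ y ∈ weightedRoots w f,
      inclWeighted K w f.discr * descend j f.natDegree.factorial w y (f.natDegree.factorial * M) =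
        inclWeighted K w (MvPowerSeries.monomial (Finsupp.single j M) 1) *
          q.eval₂ (inclWeighted K w) y := by
  set e := f.natDegree.factorial with he
  have he0 : (0 : ℚ) < e := by exact_mod_cast Nat.factorial_pos _
  obtain ⟨q, hqdeg, hq⟩ := ((isRationalFamily_descend hqo hdeg j e (e * M)).mul_single_neg
    (Finsupp.single j M)).exists_discr_mul_eq hqo hdeg (fun i y hy a ha => by
      rw [mem_support, coeff_mul_single, mul_one, sub_neg_eq_add, coeff_descend] at ha
      set b := a + Weighted.of (coordWeight i) (expHom d (Finsupp.single j M)) with hb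
      have hprod := left_ne_zero_of_mul ha
      have hbs : b ∈ y.support := right_ne_zero_of_mul ha
      have hb0 : 0 ≤ (Weighted.of (coordWeight i)).symm b i :=
        mem_supportedIn_of_eval₂_eq_zero hqo.1 hy b hbs
      have hab : (Weighted.of (coordWeight i)).symm b i =
          (Weighted.of (coordWeight i)).symm a i + (Finsupp.single j M i : ℕ) := by
        rw [hb, map_add, AddEquiv.symm_apply_apply]; rfl
      rw [mem_nonnegWeight, coordWeight_apply]
      -- In the `j`-th coordinate the exponents of `y` are of the form `m / e`, and those with `m <
      -- e * M` are killed by a factor of the product. Every other coordinate is left unchanged by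
      -- the division by `X_j^M`.
      rcases eq_or_ne j i with rfl | hji
      · rw [Finsupp.single_eq_same] at hab
        obtain ⟨z, hz⟩ := exists_int_factorial_mul hqo.1 hy hbs j
        rw [← he] at hz
        have hz0 : 0 ≤ z := by
          have : (0 : ℚ) ≤ z := hz ▸ mul_nonneg hb0 he0.le
          exact_mod_cast this
        obtain ⟨m, rfl⟩ := Int.eq_ofNat_of_zero_le hz0
        have hm : e * M ≤ m := by
          by_contra! hlt
          apply hprod
          rw [Finset.prod_eq_zero (Finset.mem_range.2 hlt), Rat.cast_zero]
          rw [sub_eq_zero, eq_div_iff he0.ne', hz, Int.cast_natCast]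
        have hm' : (e : ℚ) * M ≤ m := by exact_mod_cast hm
        rw [hab, Int.cast_natCast] at hz
        nlinarith
      · rw [Finsupp.single_eq_of_ne hji.symm, Nat.cast_zero, add_zero] at hab
        rwa [← hab])
  refine ⟨q, hqdeg, fun w y hy => ?_⟩
  rw [← hq w y hy, inclWeighted_monomial, mul_left_comm, mul_left_comm (single _ _),
    single_mul_single, add_neg_cancel, one_mul, single_zero_one, mul_one]

/-- The exponents of the roots of a quasi-ordinary polynomial are nonnegative, with bounded
denominators. -/
theorem exists_nat_factorial_mul [IsAlgClosed K] {f : (MvPowerSeries (Fin d) K)[X]}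
    (hqo : IsQuasiOrdinary f) (hdeg : 0 < f.natDegree) {w : (Fin d → ℚ) →+o ℚ}
    {y : WeightedSeries K w} (hy : y ∈ weightedRoots w f) {a : Weighted w} (ha : a ∈ y.support)
    (j : Fin d) : ∃ m : ℕ, (Weighted.of w).symm a j = (m : ℚ) / (f.natDegree.factorial : ℚ) := by
  by_contra! hno
  obtain ⟨-, α, u, hu, hD⟩ := id hqo
  obtain ⟨v, hv⟩ :=
    (MvPowerSeries.isUnit_iff_constantCoeff.2 (isUnit_iff_ne_zero.2 hu)).exists_left_inv
  set e := f.natDegree.factorial with he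
  choose q hqdeg hq using exists_monomial_mul_descend_eq hqo hdeg j
  -- By `hno` no factor of the operator vanishes at `a`, so this exponent survives for every `M`.
  -- The left side `a + α` does not depend on `M`.
  have hmem : ∀ M : ℕ, ∃ m : Fin d →₀ ℕ, ∃ c ∈ ⋃ k ∈ Finset.range f.natDegree, (y ^ k).support,
      a + Weighted.of w (expHom d α) =
        Weighted.of w (expHom d (Finsupp.single j M)) + (Weighted.of w (expHom d m) + c) := by
    intro M
    have h1 := hq M w y hy
    rw [hD, map_mul] at h1
    have h2 : inclWeighted K w (MvPowerSeries.monomial α 1) * descend j e w y (e * M) =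
        inclWeighted K w (MvPowerSeries.monomial (Finsupp.single j M) 1) *
          (Polynomial.C v * q M).eval₂ (inclWeighted K w) y := by
      rw [eval₂_mul, eval₂_C]
      have h3 : inclWeighted K w v * inclWeighted K w u = 1 := by rw [← map_mul, hv, map_one]
      linear_combination inclWeighted K w v * h1 - inclWeighted K w (MvPowerSeries.monomial α 1) *
        descend j e w y (e * M) * h3
    have h4 := congrArg (fun x : WeightedSeries K w => x.coeff (a + Weighted.of w (expHom d α))) h2
    simp only [inclWeighted_monomial, coeff_single_mul, one_mul, add_sub_cancel_right] at h4
    have h5 : (descend j e w y (e * M)).coeff a ≠ 0 := by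
      rw [coeff_descend]
      refine mul_ne_zero ?_ ha
      rw [Rat.cast_ne_zero, Finset.prod_ne_zero_iff]
      exact fun i _ => sub_ne_zero.2 (hno i)
    rw [h4] at h5
    obtain ⟨m, c, hc, hmc⟩ := exists_support_add_of_mem_support_eval₂ (n := f.natDegree)
      ((natDegree_C_mul_le _ _).trans_lt (hqdeg M)) h5
    exact ⟨m, c, hc, by rw [← hmc, add_sub_cancel]⟩
  choose m c hc hmc using hmem
  have hpwo : (Set.univ ×ˢ ⋃ k ∈ Finset.range f.natDegree, (y ^ k).support :
      Set ((Fin d →₀ ℕ) × Weighted w)).IsPWO := by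
    refine Set.IsPWO.prod (Set.isPWO_of_wellQuasiOrderedLE _) ?_
    exact (Finset.isPWO_bUnion _).2 fun k _ => (y ^ k).isPWO_support
  -- Well-ordering yields `M < M'` with both remaining terms weakly increasing, so two
  -- decompositions of the same exponent would be strictly ordered.
  obtain ⟨M, M', hlt, hle⟩ := hpwo.exists_lt (f := fun M => (m M, c M))
    fun M => ⟨Set.mem_univ _, hc M⟩
  have hle1 : m M ≤ m M' := hle.1
  have hle2 : c M ≤ c M' := hle.2
  have h1 : Weighted.of w (expHom d (m M)) ≤ Weighted.of w (expHom d (m M')) :=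
    Weighted.monotone_of w ((expHom_le_iff d _ _).2 hle1)
  have h2 : Weighted.of w (expHom d (Finsupp.single j M)) <
      Weighted.of w (expHom d (Finsupp.single j M')) := by
    refine lt_of_le_of_ne (Weighted.monotone_of w ((expHom_le_iff d _ _).2 ?_)) ?_
    · exact Finsupp.single_le_single.2 hlt.le
    · rw [ne_eq, (Weighted.of w).injective.eq_iff, (expHom_injective d).eq_iff]
      intro h
      have := DFunLike.congr_fun h j
      simp only [Finsupp.single_eq_same] at this
      omega
  exact absurd ((hmc M).symm.trans (hmc M')) (add_lt_add_of_lt_of_le h2 (add_le_add h1 hle2)).ne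

/-- **Abhyankar–Jung theorem**: the roots of a quasi-ordinary polynomial in the field of weighted
series are power series with fractional exponents. -/
theorem exists_mem_Zer_toWeighted_eq [IsAlgClosed K] {f : (MvPowerSeries (Fin d) K)[X]}
    (hqo : IsQuasiOrdinary f) (hdeg : 0 < f.natDegree) {w : (Fin d → ℚ) →+o ℚ}
    {y : WeightedSeries K w} (hy : y ∈ weightedRoots w f) :
    ∃ x ∈ Zer f, toWeighted K w x = y := by
  set e := f.natDegree.factorial with he
  have hsupp : ∀ a, y.coeff (Weighted.of w a) ≠ 0 → ∀ j, ∃ m : ℕ, a j = (m : ℚ) / (e : ℚ) :=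
    fun a ha j => by
      simpa using exists_nat_factorial_mul hqo hdeg hy ha j
  -- The support lies in a monotone image of `ℕ^d`, so Dickson's lemma makes it partially
  -- well-ordered for the componentwise order too.
  have hpwo : (Function.support fun a => y.coeff (Weighted.of w a)).IsPWO := by
    have hmono : Monotone fun m : Fin d →₀ ℕ => ((fun j => (m j : ℚ) / (e : ℚ)) : Fin d → ℚ) :=
      fun m m' h j => by
        have : (m j : ℚ) ≤ m' j := by exact_mod_cast h j
        simp only
        gcongr
    refine ((Set.isPWO_of_wellQuasiOrderedLE Set.univ).image_of_monotone hmono).mono fun a ha => ?_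
    choose m hm using hsupp a ha
    exact ⟨Finsupp.equivFunOnFinite.symm m, Set.mem_univ _, by ext j; simp [hm j]⟩
  let x : Ambient K d := ⟨fun a => y.coeff (Weighted.of w a), hpwo⟩
  have htow : toWeighted K w x = y := by
    ext a
    rw [coeff_toWeighted]
    exact congrArg y.coeff ((Weighted.of w).apply_symm_apply a)
  refine ⟨x, ⟨⟨e, Nat.factorial_pos _, hsupp⟩, ?_⟩, htow⟩
  apply toWeighted_injective w
  rw [hom_eval₂, htow, map_zero]
  exact hy

theorem image_toWeighted_Zer [IsAlgClosed K] {f : (MvPowerSeries (Fin d) K)[X]}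
    (hqo : IsQuasiOrdinary f) (hdeg : 0 < f.natDegree) (w : (Fin d → ℚ) →+o ℚ) :
    toWeighted K w '' Zer f = weightedRoots w f := by
  ext y
  constructor
  · rintro ⟨x, hx, rfl⟩
    exact toWeighted_mem_weightedRoots w hx
  · intro hy
    obtain ⟨x, hx, h⟩ := exists_mem_Zer_toWeighted_eq hqo hdeg hy
    exact ⟨x, hx, h⟩

theorem ncard_Zer [IsAlgClosed K] {f : (MvPowerSeries (Fin d) K)[X]}
    (hqo : IsQuasiOrdinary f) (hdeg : 0 < f.natDegree) : (Zer f).ncard = f.natDegree := by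
  rw [← ncard_weightedRoots hqo hdeg 0, ← image_toWeighted_Zer hqo hdeg,
    Set.ncard_image_of_injective _ (toWeighted_injective 0)]

end

end QuasiOrdinary

/-! ### Contacts between roots. -/

namespace QuasiOrdinary

open HahnSeries

variable {K : Type*} [Field K] {d : ℕ}

theorem FracPowerSeries.mono_mul {k l : ℕ} (hl : 0 < l) {x : Ambient K d}
    (hx : x ∈ FracPowerSeries K d k) : x ∈ FracPowerSeries K d (k * l) := fun a ha i => by
  obtain ⟨m, hm⟩ := hx a ha i
  refine ⟨m * l, ?_⟩
  have : (l : ℚ) ≠ 0 := Nat.cast_ne_zero.2 hl.ne'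
  rw [hm]
  push_cast
  rw [mul_div_mul_right _ _ this]

/-- A divisor in the ambient ring of a monomial times a unit has a least exponent. -/
theorem exists_isLeast_support_of_mul_eq {x x' : Ambient K d} {α : Fin d →₀ ℕ}
    {u : MvPowerSeries (Fin d) K} (hu : MvPowerSeries.constantCoeff u ≠ 0)
    (hx : x * x' = incl K d (MvPowerSeries.monomial α 1 * u)) : ∃ l, IsLeast x.support l := by
  set D := incl K d (MvPowerSeries.monomial α 1 * u) with hD
  have hDα : D.coeff (expHom d α) ≠ 0 := by
    rw [hD, coeff_incl_expHom, MvPowerSeries.coeff_monomial_mul, if_pos le_rfl, tsub_self, one_mul]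
    exact hu
  have hDle : ∀ a ∈ D.support, expHom d α ≤ a := fun a ha => by
    obtain ⟨m, rfl⟩ := exists_expHom_of_mem_support_incl ha
    rw [mem_support, hD, coeff_incl_expHom, MvPowerSeries.coeff_monomial_mul] at ha
    split_ifs at ha with h
    · exact (expHom_le_iff d _ _).2 h
    · exact absurd rfl ha
  have hD0 : D ≠ 0 := ne_zero_of_coeff_ne_zero hDα
  have hx0 : x ≠ 0 := fun h => hD0 (by rw [← hx, h, zero_mul])
  have hx'0 : x' ≠ 0 := fun h => hD0 (by rw [← hx, h, mul_zero])
  -- For `s ≠ 0`, `μ s` is the vector of coordinatewise minima of the support, each read off as an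
  -- order for a coordinate weight, hence additive on products. In general it need not lie in the
  -- support.
  let μ : Ambient K d → Fin d → ℚ := fun s j =>
    (Weighted.of (coordWeight j)).symm (toWeighted K (coordWeight j) s).order j
  have hμ : ∀ s : Ambient K d, ∀ a ∈ s.support, μ s ≤ a := fun s a ha j =>
    Weighted.weight_le (coordWeight j) (b := Weighted.of (coordWeight j) a)
      (order_le_of_coeff_ne_zero (x := toWeighted K (coordWeight j) s) ha)
  have hμmem : ∀ s : Ambient K d, s ≠ 0 → ∀ j, ∃ a ∈ s.support, μ s j = a j := fun s hs j => by
    refine ⟨(Weighted.of (coordWeight j)).symm (toWeighted K (coordWeight j) s).order, ?_, rfl⟩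
    rw [mem_support, ← coeff_toWeighted, ne_eq, coeff_order_eq_zero,
      map_eq_zero_iff _ (toWeighted_injective _)]
    exact hs
  have hadd : μ x + μ x' = expHom d α := by
    funext j
    have h1 : μ D j = μ x j + μ x' j := by
      simp only [μ]
      rw [← hx, map_mul, order_mul, map_add, Pi.add_apply]
      · rwa [ne_eq, map_eq_zero_iff _ (toWeighted_injective _)]
      · rwa [ne_eq, map_eq_zero_iff _ (toWeighted_injective _)]
    obtain ⟨a, ha, haj⟩ := hμmem D hD0 j
    rw [Pi.add_apply, ← h1]
    exact le_antisymm (hμ D _ hDα j) (haj ▸ hDle a ha j)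
  refine ⟨μ x, ?_, fun a ha => hμ x a ha⟩
  rw [← hx] at hDα
  -- Since `μ x + μ x'` is the attained exponent of the monomial, the lower bounds on `b` and `c`
  -- must be equalities.
  obtain ⟨b, hb, c, hc, hbc⟩ := support_mul_subset hDα
  have hbc' : b + c = μ x + μ x' := hbc.trans hadd.symm
  have : b = μ x := by
    refine le_antisymm (fun j => ?_) (hμ x b hb)
    have h1 := congrFun hbc' j
    have h2 := hμ x' c hc j
    simp only [Pi.add_apply] at h1
    linarith
  exact this ▸ hb

/-- Splitting off both linear factors shows that `y - z` divides `f'(y)`, which divides the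
discriminant, a monomial times a unit. -/
theorem exists_isLeast_support_sub {f : (MvPowerSeries (Fin d) K)[X]} (hqo : IsQuasiOrdinary f)
    {y z : Ambient K d} (hy : y ∈ Zer f) (hz : z ∈ Zer f) (hyz : y ≠ z) :
    ∃ l, IsLeast (y - z).support l := by
  have hdeg : 0 < f.natDegree := by
    by_contra h
    have h1 : f = 1 := hqo.1.natDegree_eq_zero.1 (by omega)
    have h2 := hy.2
    rw [h1, eval₂_one] at h2
    exact one_ne_zero h2
  obtain ⟨hf, α, u, hu, hD⟩ := id hqo
  obtain ⟨p, g, hfg⟩ := hf.exists_mul_add_derivative_mul_eq_C_discr hdeg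
  set F := f.map (incl K d) with hF
  have hy0 : F.IsRoot y := by rw [IsRoot.def, hF, eval_map]; exact hy.2
  have hz0 : F.IsRoot z := by rw [IsRoot.def, hF, eval_map]; exact hz.2
  obtain ⟨F₁, hF₁⟩ := dvd_iff_isRoot.2 hy0
  have hz1 : F₁.IsRoot z := by
    rw [IsRoot.def, hF₁, eval_mul, eval_sub, eval_X, eval_C] at hz0
    exact (mul_eq_zero.1 hz0).resolve_left (sub_ne_zero.2 hyz.symm)
  obtain ⟨F₂, hF₂⟩ := dvd_iff_isRoot.2 hz1
  refine exists_isLeast_support_of_mul_eq (x' := F₂.eval y * g.eval₂ (incl K d) y) (α := α) hu ?_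
  have h1 := congrArg (eval₂ (incl K d) y) hfg
  rw [eval₂_add, eval₂_mul, eval₂_mul, hy.2, zero_mul, zero_add, eval₂_C, hD,
    ← eval_map, ← derivative_map, ← hF, hF₁, hF₂] at h1
  rw [← h1]
  simp [derivative_mul, mul_assoc]

theorem HasContact.isLeast {y z : Ambient K d} {l : Fin d → ℚ} (h : HasContact y z l) :
    IsLeast (y - z).support l := by
  obtain ⟨k, hk, u, hu, hu0, heq⟩ := h
  rw [heq]
  constructor
  · rw [mem_support, coeff_single_mul, sub_self, one_mul]
    exact hu0
  · intro a ha
    rw [mem_support, coeff_single_mul, one_mul] at ha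
    intro i
    obtain ⟨m, hm⟩ := hu _ ha i
    have h1 : (0 : ℚ) ≤ (a - l) i := by rw [hm]; positivity
    simpa using h1

theorem hasContact_of_isLeast {y z : Ambient K d} {k k' : ℕ} (hk : 0 < k) (hk' : 0 < k')
    (hy : y ∈ FracPowerSeries K d k) (hz : z ∈ FracPowerSeries K d k') {l : Fin d → ℚ}
    (hl : IsLeast (y - z).support l) : HasContact y z l := by
  have hfrac : y - z ∈ FracPowerSeries K d (k * k') := fun a ha =>
    (support_sub_subset _ _ ha).elim (FracPowerSeries.mono_mul hk' hy a)
      (mul_comm k k' ▸ FracPowerSeries.mono_mul hk hz a)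
  have hkk : (0 : ℚ) < (k * k' : ℕ) := by exact_mod_cast Nat.mul_pos hk hk'
  refine ⟨k * k', Nat.mul_pos hk hk', single (-l) 1 * (y - z), fun a ha i => ?_, ?_, ?_⟩
  · rw [mem_support, coeff_single_mul, one_mul, sub_neg_eq_add] at ha
    obtain ⟨m, hm⟩ := hfrac _ ha i
    obtain ⟨n, hn⟩ := hfrac _ hl.1 i
    have hle := hl.2 ha i
    rw [hm, hn, div_le_div_iff_of_pos_right hkk] at hle
    have hle' : n ≤ m := by exact_mod_cast hle
    refine ⟨m - n, ?_⟩
    rw [Nat.cast_sub hle', sub_div, ← hm, ← hn]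
    simp
  · rw [coeff_single_mul, one_mul, zero_sub, neg_neg]
    exact hl.1
  · rw [← mul_assoc, single_mul_single, add_neg_cancel, one_mul, single_zero_one, one_mul]

theorem HasContact.contact_eq {y z : Ambient K d} {l : Fin d → ℚ} (h : HasContact y z l) :
    contact y z = l := by
  have hex : ∃ l, HasContact y z l := ⟨l, h⟩
  rw [contact, dif_pos hex]
  exact congrArg _ (hex.choose_spec.isLeast.unique h.isLeast)

theorem contact_self (y : Ambient K d) : contact y y = ⊤ := by
  rw [contact, dif_neg]
  rintro ⟨l, h⟩
  simpa using h.isLeast.1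

section

variable {f : (MvPowerSeries (Fin d) K)[X]}

theorem exists_contact_eq (hqo : IsQuasiOrdinary f)
    {y z : Ambient K d} (hy : y ∈ Zer f) (hz : z ∈ Zer f) (hyz : y ≠ z) :
    ∃ l : Fin d → ℚ, IsLeast (y - z).support l ∧ contact y z = l := by
  obtain ⟨l, hl⟩ := exists_isLeast_support_sub hqo hy hz hyz
  obtain ⟨⟨k, hk, hyk⟩, -⟩ := hy
  obtain ⟨⟨k', hk', hzk⟩, -⟩ := hz
  exact ⟨l, hl, (hasContact_of_isLeast hk hk' hyk hzk hl).contact_eq⟩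

theorem contact_eq_top_iff (hqo : IsQuasiOrdinary f)
    {y z : Ambient K d} (hy : y ∈ Zer f) (hz : z ∈ Zer f) :
    contact y z = ⊤ ↔ y = z := by
  constructor
  · intro h
    by_contra hyz
    obtain ⟨l, -, hl⟩ := exists_contact_eq hqo hy hz hyz
    rw [hl] at h
    exact WithTop.coe_ne_top h
  · rintro rfl
    exact contact_self y

/-- A criterion in terms of supports, from which the ultrametric inequality follows although
contacts are only partially ordered. -/
theorem lt_contact_iff (hqo : IsQuasiOrdinary f)
    {y z : Ambient K d} (hy : y ∈ Zer f) (hz : z ∈ Zer f) {l : Fin d → ℚ} :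
    (l : WithTop (Fin d → ℚ)) < contact y z ↔ ∀ a ∈ (y - z).support, l < a := by
  rcases eq_or_ne y z with rfl | hyz
  · rw [contact_self]
    simp
  obtain ⟨m, hm, h⟩ := exists_contact_eq hqo hy hz hyz
  rw [h, WithTop.coe_lt_coe]
  exact ⟨fun hlt a ha => hlt.trans_le (hm.2 ha), fun h => h m hm.1⟩

theorem contact_comm (hqo : IsQuasiOrdinary f)
    {y z : Ambient K d} (hy : y ∈ Zer f) (hz : z ∈ Zer f) :
    contact y z = contact z y := by
  rcases eq_or_ne y z with rfl | hyz
  · rfl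
  obtain ⟨m, hm, h⟩ := exists_contact_eq hqo hy hz hyz
  obtain ⟨m', hm', h'⟩ := exists_contact_eq hqo hz hy hyz.symm
  rw [← neg_sub, HahnSeries.support_neg] at hm'
  rw [h, h', hm.unique hm']

theorem lt_contact_trans (hqo : IsQuasiOrdinary f)
    {x y z : Ambient K d} (hx : x ∈ Zer f) (hy : y ∈ Zer f) (hz : z ∈ Zer f)
    {l : Fin d → ℚ} (hxy : (l : WithTop (Fin d → ℚ)) < contact x y)
    (hyz : (l : WithTop (Fin d → ℚ)) < contact y z) :
    (l : WithTop (Fin d → ℚ)) < contact x z := by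
  rw [lt_contact_iff hqo hx hy] at hxy
  rw [lt_contact_iff hqo hy hz] at hyz
  rw [lt_contact_iff hqo hx hz]
  intro a ha
  rw [← sub_add_sub_cancel x y z] at ha
  exact (support_add_subset _ _ ha).elim (hxy a) (hyz a)

theorem coeff_eq_of_lt_contact (hqo : IsQuasiOrdinary f)
    {x y : Ambient K d} (hx : x ∈ Zer f) (hy : y ∈ Zer f)
    {l a : Fin d → ℚ} (hxy : (l : WithTop (Fin d → ℚ)) < contact x y) (ha : a ≤ l) :
    x.coeff a = y.coeff a := by
  rw [lt_contact_iff hqo hx hy] at hxy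
  by_contra hne
  have := hxy a (by rw [mem_support, HahnSeries.coeff_sub]; exact sub_ne_zero.2 hne)
  exact absurd (ha.trans_lt this) (lt_irrefl a)

theorem coeff_ne_of_contact_eq (hqo : IsQuasiOrdinary f)
    {x y : Ambient K d} (hx : x ∈ Zer f) (hy : y ∈ Zer f)
    {l : Fin d → ℚ} (hxy : contact x y = l) : x.coeff l ≠ y.coeff l := by
  have hne : x ≠ y := by
    rintro rfl
    rw [contact_self] at hxy
    exact WithTop.top_ne_coe hxy
  obtain ⟨m, hm, h⟩ := exists_contact_eq hqo hx hy hne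
  obtain rfl : m = l := WithTop.coe_injective (h.symm.trans hxy)
  have := hm.1
  rwa [mem_support, HahnSeries.coeff_sub, sub_ne_zero] at this

end

end QuasiOrdinary

/-! ### The tree model: heights, contacts, and the two counts of roots. -/

namespace QuasiOrdinary

open HahnSeries

variable {K : Type*} [Field K] {d g : ℕ}

theorem IsBar.subset {Z B : Set (Ambient K d)} (hB : IsBar Z B) : B ⊆ Z := by
  induction hB with
  | root => exact subset_rfl
  | postbar B B' _ hpost ih =>
    obtain ⟨_, -, _, -, rfl⟩ := hpost
    exact fun z hz => ih hz.1

theorem heightSeq_of_lt {h : Fin g → Fin d → ℚ} {i : ℕ} (hi : i < g) :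
    heightSeq h i = (h ⟨i, hi⟩ : WithTop (Fin d → ℚ)) := dif_pos hi

theorem heightSeq_of_le {h : Fin g → Fin d → ℚ} {i : ℕ} (hi : g ≤ i) : heightSeq h i = ⊤ :=
  dif_neg (not_lt.2 hi)

/-- The class of `y` in the bar `B` of height `c`. -/
def postbarOf (B : Set (Ambient K d)) (c : Fin d → ℚ) (y : Ambient K d) : Set (Ambient K d) :=
  {z | z ∈ B ∧ (c : WithTop (Fin d → ℚ)) < contact z y}

theorem mem_postbarOf_self {B : Set (Ambient K d)} (c : Fin d → ℚ) {y : Ambient K d} (hy : y ∈ B) :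
    y ∈ postbarOf B c y := ⟨hy, by rw [contact_self]; exact WithTop.coe_lt_top c⟩

theorem isPostbar_postbarOf {B : Set (Ambient K d)} {c : Fin d → ℚ} (hB : IsHeight B c)
    {y : Ambient K d} (hy : y ∈ B) : IsPostbar B (postbarOf B c y) := ⟨c, hB, y, hy, rfl⟩

theorem lattice_mono (h : Fin g → Fin d → ℚ) {i k : ℕ} (hik : i ≤ k) : lattice h i ≤ lattice h k :=
  AddSubgroup.closure_mono (Set.union_subset_union_right _
    (Set.image_mono fun _ (hj : _ < i) => hj.trans_le hik))

section

variable {f : (MvPowerSeries (Fin d) K)[X]} {h : Fin g → Fin d → ℚ}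

namespace IsTreeOfType

theorem exists_bar (hT : IsTreeOfType (treeModel f) h) (i : Fin g) :
    ∃ B, IsBar (Zer f) B ∧ IsHeight B (h i : WithTop (Fin d → ℚ)) := by
  have : ((h i : Fin d → ℚ) : WithTop (Fin d → ℚ)) ∈ {c | ∃ B ∈ treeModel f, IsHeight B c} := by
    rw [hT.heights]
    exact Or.inr ⟨i, rfl⟩
  exact this

theorem height_eq_top_or_exists (hT : IsTreeOfType (treeModel f) h) {B : Set (Ambient K d)}
    {c : WithTop (Fin d → ℚ)} (hB : IsBar (Zer f) B) (hc : IsHeight B c) :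
    c = ⊤ ∨ ∃ i, c = (h i : WithTop (Fin d → ℚ)) := by
  have : c ∈ {c | ∃ B ∈ treeModel f, IsHeight B c} := ⟨B, hB, hc⟩
  rw [hT.heights] at this
  rcases this with h1 | ⟨i, hi⟩
  · exact Or.inl h1
  · exact Or.inr ⟨i, hi.symm⟩

theorem isBar_postbarOf_and_isHeight (hT : IsTreeOfType (treeModel f) h) {B : Set (Ambient K d)}
    (hB : IsBar (Zer f) B) {i : ℕ} (hi : i < g) (hc : IsHeight B (heightSeq h i)) {y : Ambient K d}
    (hy : y ∈ B) : IsBar (Zer f) (postbarOf B (h ⟨i, hi⟩) y) ∧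
      IsHeight (postbarOf B (h ⟨i, hi⟩) y) (heightSeq h (i + 1)) := by
  rw [heightSeq_of_lt hi] at hc
  have hpost := isPostbar_postbarOf hc hy
  exact ⟨IsBar.postbar _ _ hB hpost, hT.height_postbars ⟨i, hi⟩ B hB hc _ hpost⟩

/-- Elements of a postbar have contact greater than `hᵢ` with a common root, hence with each other,
and the height of the postbar is one of these contacts. -/
theorem lt_succ (hqo : IsQuasiOrdinary f) (hT : IsTreeOfType (treeModel f) h) {i : ℕ}
    (hi : i + 1 < g) : h ⟨i, by omega⟩ < h ⟨i + 1, hi⟩ := by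
  have hig : i < g := by omega
  obtain ⟨B, hB, hc⟩ := hT.exists_bar ⟨i, hig⟩
  obtain ⟨y, hy, -⟩ := hc.1
  obtain ⟨-, hc'⟩ := hT.isBar_postbarOf_and_isHeight hB hig
    (by rwa [heightSeq_of_lt hig]) hy
  rw [heightSeq_of_lt hi] at hc'
  obtain ⟨a, ha, b, hb, hab⟩ := hc'.1
  have hZ := hB.subset
  rw [← WithTop.coe_lt_coe, ← hab]
  refine lt_contact_trans hqo (hZ ha.1) (hZ hy) (hZ hb.1) ha.2 ?_
  rw [contact_comm hqo (hZ hy) (hZ hb.1)]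
  exact hb.2

theorem strictMono (hqo : IsQuasiOrdinary f) (hT : IsTreeOfType (treeModel f) h) :
    StrictMono h := by
  cases g with
  | zero => exact fun i => i.elim0
  | succ g =>
    refine Fin.strictMono_iff_lt_succ.2 fun i => ?_
    exact hT.lt_succ hqo (i := i) (by omega)

/-- `Zer f` contains every bar, so its height is below all the others and must be the first. That it
has a height at all follows from the existence of some bar with a height: either this bar is `Zer
f`, or a postbar was formed from `Zer f`. -/
theorem isHeight_root (hqo : IsQuasiOrdinary f) (hT : IsTreeOfType (treeModel f) h) :
    IsHeight (Zer f) (heightSeq h 0) := by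
  have hex : ∃ c, IsHeight (Zer f) c := by
    have : (⊤ : WithTop (Fin d → ℚ)) ∈ {c | ∃ B ∈ treeModel f, IsHeight B c} := by
      rw [hT.heights]; exact Or.inl rfl
    obtain ⟨B, hB, hc⟩ := this
    have key : ∀ B, IsBar (Zer f) B → B = Zer f ∨ ∃ c, IsHeight (Zer f) c := by
      intro B hB
      induction hB with
      | root => exact Or.inl rfl
      | postbar B B' _ hpost ih =>
        rcases ih with rfl | ih
        · obtain ⟨c, hc, -⟩ := hpost
          exact Or.inr ⟨c, hc⟩
        · exact Or.inr ih
    rcases key B hB with rfl | h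
    · exact ⟨_, hc⟩
    · exact h
  obtain ⟨c, hc⟩ := hex
  rcases Nat.eq_zero_or_pos g with rfl | hg
  · rw [heightSeq_of_le le_rfl]
    rcases hT.height_eq_top_or_exists IsBar.root hc with rfl | ⟨i, -⟩
    · exact hc
    · exact i.elim0
  · rw [heightSeq_of_lt hg]
    obtain ⟨B, hB, hBh⟩ := hT.exists_bar ⟨0, hg⟩
    obtain ⟨a, ha, b, hb, hab⟩ := hBh.1
    have hle := hc.2 ⟨a, hB.subset ha, b, hB.subset hb, hab⟩
    rcases hT.height_eq_top_or_exists IsBar.root hc with rfl | ⟨i, rfl⟩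
    · exact absurd (top_le_iff.1 hle) WithTop.coe_ne_top
    · have h1 : i ≤ ⟨0, hg⟩ := (hT.strictMono hqo).le_iff_le.1 (WithTop.coe_le_coe.1 hle)
      have h2 : i = ⟨0, hg⟩ := le_antisymm h1 (Fin.mk_le_of_le_val (Nat.zero_le _))
      rwa [← h2]

theorem subsingleton_of_isHeight_top (hqo : IsQuasiOrdinary f) {B : Set (Ambient K d)}
    (hB : B ⊆ Zer f) (hc : IsHeight B ⊤) : B.Subsingleton := fun a ha b hb => by
  rw [← contact_eq_top_iff hqo (hB ha) (hB hb)]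
  exact top_le_iff.1 (hc.2 ⟨a, ha, b, hb, rfl⟩)

/-- A bar of height `hᵢ₊₁` has at most `[N_g : Nᵢ]` elements. -/
theorem ncard_le_relIndex (hqo : IsQuasiOrdinary f) (hfin : (Zer f).Finite)
    (hT : IsTreeOfType (treeModel f) h) (n : ℕ) : ∀ i, i + n = g → ∀ B, IsBar (Zer f) B →
      IsHeight B (heightSeq h i) → B.ncard ≤ (lattice h i).relIndex (lattice h g) := by
  classical
  induction n with
  | zero =>
    intro i hi B hB hc
    have hig : i = g := hi
    rw [heightSeq_of_le hig.ge] at hc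
    rw [hig, AddSubgroup.relIndex_self]
    exact (Set.ncard_le_one (hfin.subset hB.subset)).2 fun a ha b hb =>
      subsingleton_of_isHeight_top hqo hB.subset hc ha hb
  | succ n ih =>
    intro i hi B hB hc
    have hig : i < g := by omega
    have hBfin := hfin.subset hB.subset
    -- `ncard` is `0` on infinite sets, so finiteness is needed for `hcard` to count the postbars.
    have hPfin : {B' | IsPostbar B B'}.Finite := by
      refine hBfin.finite_subsets.subset ?_
      rintro B' ⟨_, -, _, -, rfl⟩ z hz
      exact hz.1
    have hc' := hc
    rw [heightSeq_of_lt hig] at hc'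
    have hcard := hT.card_postbars ⟨i, hig⟩ B hB hc'
    rw [← AddSubgroup.relIndex_mul_relIndex (lattice h i) (lattice h (i + 1)) (lattice h g)
      (lattice_mono h (by omega)) (lattice_mono h (by omega)), ← hcard, mul_comm,
      Set.ncard_eq_toFinset_card _ hBfin, Set.ncard_eq_toFinset_card _ hPfin]
    refine Finset.card_le_mul_card_image_of_maps_to
      (f := fun y => postbarOf B (h ⟨i, hig⟩) y) (fun y hy => ?_) _ fun b hb => ?_
    · rw [Set.Finite.mem_toFinset] at hy ⊢
      exact isPostbar_postbarOf hc' hy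
    · rw [Set.Finite.mem_toFinset] at hb
      have hbar : IsBar (Zer f) b := IsBar.postbar _ _ hB hb
      have hbh : IsHeight b (heightSeq h (i + 1)) := hT.height_postbars ⟨i, hig⟩ B hB hc' b hb
      refine le_trans ?_ (ih (i + 1) (by omega) b hbar hbh)
      rw [← Set.ncard_coe_finset]
      refine Set.ncard_le_ncard ?_ (hfin.subset hbar.subset)
      intro y hy
      simp only [Finset.coe_filter, Set.Finite.mem_toFinset, Set.mem_ofPred_eq] at hy
      rw [← hy.2]
      exact mem_postbarOf_self _ hy.1

/-- A root can be separated from `y` at level `i` only if its contact with `y` is `hᵢ`. At `i = g`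
the bar is a single point, so every other root has some `hⱼ` as its contact with `y`. -/
theorem exists_bar_mem (hqo : IsQuasiOrdinary f) (hT : IsTreeOfType (treeModel f) h)
    {y : Ambient K d} (hy : y ∈ Zer f) (i : ℕ) (hi : i ≤ g) :
    ∃ B, IsBar (Zer f) B ∧ IsHeight B (heightSeq h i) ∧ y ∈ B ∧
      ∀ z ∈ Zer f, (∀ j, contact z y ≠ (h j : WithTop (Fin d → ℚ))) → z ∈ B := by
  induction i with
  | zero => exact ⟨_, IsBar.root, hT.isHeight_root hqo, hy, fun z hz _ => hz⟩
  | succ i ih =>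
    obtain ⟨B, hB, hc, hyB, hall⟩ := ih (by omega)
    have hig : i < g := by omega
    obtain ⟨h1, h2⟩ := hT.isBar_postbarOf_and_isHeight hB hig hc hyB
    refine ⟨_, h1, h2, mem_postbarOf_self _ hyB, fun z hz hne => ⟨hall z hz hne, ?_⟩⟩
    rw [heightSeq_of_lt hig] at hc
    exact lt_of_le_of_ne (hc.2 ⟨z, hall z hz hne, y, hyB, rfl⟩) (hne _).symm

theorem contacts_eq_range (hqo : IsQuasiOrdinary f) (hT : IsTreeOfType (treeModel f) h)
    {y : Ambient K d} (hy : y ∈ Zer f) :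
    {c | ∃ z ∈ Zer f, z ≠ y ∧ contact z y = c} =
      Set.range fun i : Fin g => ((h i : Fin d → ℚ) : WithTop (Fin d → ℚ)) := by
  ext c
  constructor
  · rintro ⟨z, hz, hzy, rfl⟩
    by_contra hno
    obtain ⟨B, hB, hc, hyB, hall⟩ := hT.exists_bar_mem hqo hy g le_rfl
    rw [heightSeq_of_le le_rfl] at hc
    exact hzy (subsingleton_of_isHeight_top hqo hB.subset hc
      (hall z hz fun j hj => hno ⟨j, hj.symm⟩) hyB)
  · rintro ⟨i, rfl⟩
    obtain ⟨B, hB, hc, hyB, -⟩ := hT.exists_bar_mem hqo hy i i.2.le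
    rw [heightSeq_of_lt i.2] at hc
    obtain ⟨a, ha, b, hb, hab⟩ := hc.1
    have hZ := hB.subset
    have key : ∀ z ∈ B, ¬ (h i : WithTop (Fin d → ℚ)) < contact z y →
        ∃ z ∈ Zer f, z ≠ y ∧ contact z y = (h i : WithTop (Fin d → ℚ)) := fun z hz hlt => by
      have heq := (eq_of_le_of_not_lt (hc.2 ⟨z, hz, y, hyB, rfl⟩) hlt).symm
      refine ⟨z, hZ hz, ?_, heq⟩
      rintro rfl
      rw [contact_self] at heq
      exact WithTop.top_ne_coe heq
    -- The pair `a`, `b` realizes the height, so by the ultrametric inequality they cannot both be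
    -- closer than `hᵢ` to `y`.
    by_cases h1 : (h i : WithTop (Fin d → ℚ)) < contact a y
    · by_cases h2 : (h i : WithTop (Fin d → ℚ)) < contact b y
      · rw [contact_comm hqo (hZ hb) (hZ hyB)] at h2
        have := lt_contact_trans hqo (hZ ha) (hZ hyB) (hZ hb) h1 h2
        rw [hab] at this
        exact absurd this (lt_irrefl _)
      · exact key b hb h2
    · exact key a ha h1

/-- Some root has all the `hᵢ` among its exponents. -/
theorem exists_root_forall_mem_support (hqo : IsQuasiOrdinary f)
    (hT : IsTreeOfType (treeModel f) h) : ∃ y ∈ Zer f, ∀ i, h i ∈ y.support := by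
  have key : ∀ n ≤ g, ∃ B, IsBar (Zer f) B ∧ IsHeight B (heightSeq h n) ∧
      ∀ y ∈ B, ∀ i : Fin g, (i : ℕ) < n → h i ∈ y.support := by
    intro n
    induction n with
    | zero => exact fun _ => ⟨_, IsBar.root, hT.isHeight_root hqo, fun y _ i hi => by omega⟩
    | succ n ih =>
      intro hn
      obtain ⟨B, hB, hc, hsupp⟩ := ih (by omega)
      have hng : n < g := by omega
      have hZ := hB.subset
      -- Two elements realizing the height differ in this coefficient, so one of the two
      -- coefficients is nonzero. The whole postbar of that element shares it.
      have hex : ∃ a ∈ B, h ⟨n, hng⟩ ∈ a.support := by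
        rw [heightSeq_of_lt hng] at hc
        obtain ⟨a, ha, b, hb, hab⟩ := hc.1
        by_contra! hno
        have h1 := hno a ha
        have h2 := hno b hb
        rw [mem_support, not_not] at h1 h2
        exact coeff_ne_of_contact_eq hqo (hZ ha) (hZ hb) hab (h1.trans h2.symm)
      obtain ⟨a, ha, hasupp⟩ := hex
      obtain ⟨h1, h2⟩ := hT.isBar_postbarOf_and_isHeight hB hng hc ha
      refine ⟨_, h1, h2, fun y hy i hi => ?_⟩
      rcases Nat.lt_succ_iff_lt_or_eq.1 hi with hlt | heq
      · exact hsupp y hy.1 i hlt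
      · obtain rfl : i = ⟨n, hng⟩ := Fin.ext heq
        rw [mem_support, coeff_eq_of_lt_contact hqo (hZ hy.1) (hZ ha) hy.2 le_rfl]
        exact hasupp
  obtain ⟨B, hB, hc, hsupp⟩ := key g le_rfl
  obtain ⟨y, hy, -⟩ := hc.1
  exact ⟨y, hB.subset hy, fun i => hsupp y hy i i.2⟩

end IsTreeOfType

/-- If `h₁,…,h_g` are exponents of a root of the monic polynomial `p`, then `p` has degree at
least `[N_g : N₀]`: the conjugates of the root under the characters of `N_g / N₀` are distinct. -/
theorem relIndex_le_natDegree [IsAlgClosed K] [CharZero K] {p : (MvPowerSeries (Fin d) K)[X]}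
    (hp : p.Monic) (hfin : (lattice h 0).relIndex (lattice h g) ≠ 0) {w : (Fin d → ℚ) →+o ℚ}
    {y : WeightedSeries K w} (hy : y ∈ weightedRoots w p)
    (hsupp : ∀ i, Weighted.of w (h i) ∈ y.support) :
    (lattice h 0).relIndex (lattice h g) ≤ p.natDegree := by
  classical
  let N := lattice h g
  let N₀ := (lattice h 0).addSubgroupOf N
  let G := N ⧸ N₀
  have hcardG : Nat.card (Multiplicative G) = (lattice h 0).relIndex (lattice h g) := rfl
  have hGfin : Finite (Multiplicative G) := Nat.finite_of_card_ne_zero (by rwa [hcardG])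
  -- In characteristic zero `K` has enough roots of unity, so the finite group `G` has as many
  -- characters as elements.
  have : NeZero (Monoid.exponent (Multiplicative G) : K) :=
    ⟨Nat.cast_ne_zero.2 Monoid.exponent_ne_zero_of_finite⟩
  have hchar : Nat.card (Multiplicative G →* Kˣ) = (lattice h 0).relIndex (lattice h g) := by
    rw [CommGroup.card_monoidHom_of_hasEnoughRootsOfUnity, hcardG]
  have hext : ∀ φ : Multiplicative G →* Kˣ, ∃ χ : (Fin d → ℚ) →+ Additive Kˣ,
      ∀ a : N, χ a = Additive.ofMul (φ (Multiplicative.ofAdd (QuotientAddGroup.mk a))) := by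
    intro φ
    obtain ⟨χ, hχ⟩ := exists_addMonoidHom_extension (K := K) N.subtype N.subtype_injective
      ((MonoidHom.toAdditive φ).comp
        ((AddEquiv.additiveMultiplicative G).symm.toAddMonoidHom.comp (QuotientAddGroup.mk' N₀)))
    exact ⟨χ, fun a => DFunLike.congr_fun hχ a⟩
  choose χ hχ using hext
  have hsub : lattice h 0 ≤ N := lattice_mono h (Nat.zero_le g)
  have hzero : ∀ φ, ∀ a ∈ lattice h 0, χ φ a = 0 := fun φ a ha => by
    have h1 := hχ φ ⟨a, hsub ha⟩
    have h2 : (QuotientAddGroup.mk (⟨a, hsub ha⟩ : N) : G) = 0 :=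
      (QuotientAddGroup.eq_zero_iff _).2 (AddSubgroup.mem_addSubgroupOf.2 ha)
    rw [h1, h2, ofAdd_zero, map_one, ofMul_one]
  have hexp : ∀ φ (m : Fin d →₀ ℕ), χ φ (expHom d m) = 0 := fun φ m => by
    refine hzero φ _ (AddSubgroup.subset_closure (Or.inl ⟨fun i => m i, ?_⟩))
    ext i
    simp [expHom]
  let X : (Multiplicative G →* Kˣ) → Weighted w →+ Additive Kˣ := fun φ =>
    (χ φ).comp (Weighted.of w).symm.toAddMonoidHom
  -- A character of `N_g / N_0` is determined by its values at the `hᵢ`, and these can be read off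
  -- from the nonzero coefficients of `y` there.
  have hinj : Function.Injective fun φ => twist (X φ) y := by
    intro φ φ' heq
    have hgen : ∀ i, χ φ (h i) = χ φ' (h i) := fun i => by
      have h1 := congrArg (fun s : WeightedSeries K w => s.coeff (Weighted.of w (h i))) heq
      simp only [coeff_twist] at h1
      have h2 := mul_right_cancel₀ (hsupp i) h1
      exact Additive.toMul.injective (Units.ext h2)
    have hall : ∀ a ∈ N, χ φ a = χ φ' a := fun a ha => by
      refine AddSubgroup.closure_induction (p := fun a _ => χ φ a = χ φ' a) ?_ ?_ ?_ ?_ ha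
      · rintro b (hb | ⟨i, -, rfl⟩)
        · have hb0 : b ∈ lattice h 0 := AddSubgroup.subset_closure (Or.inl hb)
          rw [hzero φ b hb0, hzero φ' b hb0]
        · exact hgen i
      · simp
      · intro b c _ _ hb hc
        rw [map_add, map_add, hb, hc]
      · intro b _ hb
        rw [map_neg, map_neg, hb]
    refine MonoidHom.ext fun q => ?_
    obtain ⟨a, ha⟩ := QuotientAddGroup.mk_surjective (Multiplicative.toAdd q)
    have h1 := hall a a.2
    rw [hχ, hχ, ha] at h1
    exact Additive.ofMul.injective h1
  have hmem : ∀ φ, twist (X φ) y ∈ weightedRoots w p := fun φ =>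
    twist_mem_weightedRoots (fun m => hexp φ m) hy
  rw [← hchar]
  refine le_trans ?_ (ncard_weightedRoots_le w hp)
  rw [← Nat.card_coe_set_eq]
  have := (weightedRoots_finite w hp).to_subtype
  exact Nat.card_le_card_of_injective (fun φ => (⟨twist (X φ) y, hmem φ⟩ : weightedRoots w p))
    fun φ φ' heq => hinj (congrArg Subtype.val heq)

/-- A quasi-ordinary polynomial with a tree model of type `(h₁,…,h_g)` is irreducible. -/
theorem IsTreeOfType.irreducible [IsAlgClosed K] [CharZero K] (hqo : IsQuasiOrdinary f)
    (hT : IsTreeOfType (treeModel f) h) : Irreducible f := by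
  obtain ⟨y, hy, hsupp⟩ := hT.exists_root_forall_mem_support hqo
  have hf := hqo.1
  have hf1 : f ≠ 1 := by
    rintro rfl
    have h2 := hy.2
    rw [eval₂_one] at h2
    exact one_ne_zero h2
  have hdeg : 0 < f.natDegree := by
    by_contra h0
    exact hf1 (hf.natDegree_eq_zero.1 (by omega))
  have hcard := ncard_Zer hqo hdeg
  have hfin : (Zer f).Finite := Set.finite_of_ncard_pos (by omega)
  have hle : f.natDegree ≤ (lattice h 0).relIndex (lattice h g) :=
    hcard ▸ hT.ncard_le_relIndex hqo hfin g 0 (zero_add g) _ IsBar.root (hT.isHeight_root hqo)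
  have hroot : ∀ p : (MvPowerSeries (Fin d) K)[X], p.Monic → p.eval₂ (incl K d) y = 0 →
      f.natDegree ≤ p.natDegree := fun p hp hpy => by
    -- An infinite index is recorded as `0`; here `0 < f.natDegree` and `hle` exclude it. Any weight
    -- would do, and `0` gives the lexicographic order.
    refine hle.trans (relIndex_le_natDegree hp (by omega) (w := 0) (y := toWeighted K 0 y) ?_
      fun i => ?_)
    · have h1 := congrArg (toWeighted K 0) hpy
      rwa [hom_eval₂, map_zero] at h1
    · rw [HahnSeries.mem_support, coeff_toWeighted, AddEquiv.symm_apply_apply]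
      exact hsupp i
  rw [hf.irreducible_iff_natDegree]
  refine ⟨hf1, fun p q hp hq hpq => ?_⟩
  have hdeg' : p.natDegree + q.natDegree = f.natDegree := by rw [← hpq, hp.natDegree_mul hq]
  have h0 := hy.2
  rw [← hpq, eval₂_mul] at h0
  rcases mul_eq_zero.1 h0 with h1 | h1
  · right; have := hroot p hp h1; omega
  · left; have := hroot q hq h1; omega

end

end QuasiOrdinary

theorem theorem5 {K : Type*} [Field K] [IsAlgClosed K] [CharZero K] {d g : ℕ}
    (f : Polynomial (MvPowerSeries (Fin d) K))
    (hqo : QuasiOrdinary.IsQuasiOrdinary f) (hW : QuasiOrdinary.IsWeierstrass f)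
    (h : Fin g → Fin d → ℚ)
    (hT : QuasiOrdinary.IsTreeOfType (QuasiOrdinary.treeModel f) h) :
    Irreducible f ∧ QuasiOrdinary.IsCharacteristicSequence f h := by
  obtain ⟨y, hy, -⟩ := hT.exists_root_forall_mem_support hqo
  exact ⟨hT.irreducible hqo, hT.strictMono hqo, ⟨y, hy⟩,
    fun y hy => hT.contacts_eq_range hqo hy⟩
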